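/- **Conventions.** Let $\mathcal C$ be a small additive category, $\mathbb E\colon\mathcal C^{op}\times\mathcal C\to Ab$ a biadditive functor, and $\mathfrak s$ a map assigning to each $\delta\in\mathbb E(C,A)$ an equivalence class $\mathfrak s(\delta)=[A\xrightarrow{x}B\xrightarrow{y}C]$ of sequences, where two sequences with the same ends are equivalent if there is an isomorphism of the middle terms compatible with the identities of the ends. Write $a_*\delta=\mathbb E(C,a)(\delta)$, $c^*\delta=\mathbb E(c,A)(\delta)$, and call $(A\xrightarrow{x}B\xrightarrow{y}C,\delta)$ an $\mathfrak s$-triangle if $\mathfrak s(\delta)=[A\xrightarrow{x}B\xrightarrow{y}C]$; then $x$ is an $\mathfrak s$-inflation and $y$ an $\mathfrak s$-deflation. The triplet $(\mathcal C,\mathbb E,\mathfrak s)$ is *weakly extriangulated* if: * for every $\mathfrak s$-triangle and every object $X$, the sequences $\mathcal C(X,A)\to\mathcal C(X,B)\to\mathcal C(X,C)\xrightarrow{f\mapsto f^*\delta}\mathbb E(X,A)$ and $\mathcal C(C,X)\to\mathcal C(B,X)\to\mathcal C(A,X)\xrightarrow{g\mapsto g_*\delta}\mathbb E(C,X)$ are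 exact; * $0\in\mathbb E(0,A)$ and $0\in\mathbb E(A,0)$ are realized by $A\xrightarrow{\mathrm{id}}A\to0$ and $0\to A\xrightarrow{\mathrm{id}}A$; * for $\mathfrak s$-triangles $(A\xrightarrow{x}B\xrightarrow{y}C,\delta)$ and $(A'\xrightarrow{x'}B'\xrightarrow{y'}C,a_*\delta)$ with $a\in\mathcal C(A,A')$ there is $b\in\mathcal C(B,B')$ with $bx=x'a$, $y'b=y$ such that $A\xrightarrow{\left[\begin{smallmatrix}x\\a\end{smallmatrix}\right]}B\oplus A'\xrightarrow{[b\ -x']}B'$ with $y'^*\delta$ is an $\mathfrak s$-triangle; and dually, for $\mathfrak s$-triangles $(A\xrightarrow{x}B\xrightarrow{y}C,\delta)$ and $(A\xrightarrow{x'}B'\xrightarrow{y'}C',c^*\delta)$ with $c\in\mathcal C(C',C)$ there is $b\in\mathcal C(B',B)$ with $bx'=x$, $yb=cy'$ such that $B'\xrightarrow{\left[\begin{smallmatrix}-y'\\b\end{smallmatrix}\right]}C'\oplus B\xrightarrow{[c\ y]}C$ with $x'_*\delta$ is an $\mathfrak s$-triangle. It is *extriangulated* if moreover $\mathfrak s$-inflations,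 and $\mathfrak s$-deflations, are closed under composition. An *exact functor* $(F,\phi)\colon(\mathcal C,\mathbb E,\mathfrak s)\to(\mathcal C',\mathbb E',\mathfrak s')$ is an additive functor $F$ with a natural transformation $\phi\colon\mathbb E\Rightarrow\mathbb E'\circ(F^{op}\times F)$ such that $\mathfrak s'(\phi_{C,A}(\delta))=[FA\xrightarrow{Fx}FB\xrightarrow{Fy}FC]$ for every $\mathfrak s$-triangle $(A\xrightarrow{x}B\xrightarrow{y}C,\delta)$. Composition is $(F',\phi')\circ(F,\phi)=(F'F,(\phi'\circ(F^{op}\times F))\cdot\phi)$. A class of morphisms is a *multiplicative system* if it contains identities, is closed under composition, and admits a left and a right calculus of fractions. For a class $\mathcal S$ of morphisms of $\mathcal C$, let $\mathcal N_{\mathcal S}$ be the full subcategory of those $N$ for which $N\to0$ and $0\to N$ lie in $\mathcal S$, let $p\colon\mathcal C\to\overline{\mathcal C}=\mathcal C/[\mathcal N_{\mathcal S}]$, $f\mapsto\overline f$, be the ideal quotient, and let $\overline{\mathcal S}$ be the smallest class of morphisms of $\overline{\mathcal C}$ that contains $p(\mathcal S)$ and all isomorphisms and is closed under composition. **Exact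 localization.** Let $Q\colon\mathcal C\to\widetilde{\mathcal C}$ be the localization of $\mathcal C$ by $\mathcal S$. For objects $A,C$ of $\mathcal C$ consider triplets $(C\xleftarrow{t}Z,\ \delta\in\mathbb E(Z,X),\ X\xleftarrow{s}A)$ with $\overline s,\overline t\in\overline{\mathcal S}$, and let $\mathcal K(C,A)\subseteq\mathbb E(C,A)$ consist of the $\delta$ with $s_*\delta=0$ for some $s$ with $\overline s\in\overline{\mathcal S}$. Two triplets $(t_i,\delta_i,s_i)$, $i=1,2$, are related if there are $u_i,v_i,s,t$ with classes in $\overline{\mathcal S}$ such that $\overline s=\overline{u_is_i}$ and $\overline t=\overline{t_iv_i}$ for $i=1,2$, and $v_1^*u_{1*}\delta_1-v_2^*u_{2*}\delta_2\in\mathcal K$. An *exact localization* of $(\mathcal C,\mathbb E,\mathfrak s)$ by $\mathcal S$ is a weakly extriangulated category $(\widetilde{\mathcal C},\widetilde{\mathbb E},\widetilde{\mathfrak s})$ on $\widetilde{\mathcal C}$, with an additive structure for which $Q$ is additive, together with an exact functor $(Q,\mu)\colon(\mathcal C,\mathbb E,\mathfrak s)\to(\widetilde{\mathcal C},\widetilde{\mathbb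 E},\widetilde{\mathfrak s})$, such that $\widetilde{\mathbb E}(QC,QA)$ is (identified with) the set of classes $[t\backslash\delta/s]$ of triplets under the equivalence relation generated by this relation, and * $[t\backslash\delta_1/s]+[t\backslash\delta_2/s]=[t\backslash\delta_1+\delta_2/s]$; * $\alpha_*[t\backslash\delta/s]=[t\backslash a'_*\delta/s'u]$ if $\alpha=Q(u)^{-1}Q(a)$ and $\overline{a's}=\overline{s'a}$ with $\overline u,\overline{s'}\in\overline{\mathcal S}$; * $\gamma^*[t\backslash\delta/s]=[vt'\backslash c'^*\delta/s]$ if $\gamma=Q(c)Q(v)^{-1}$ and $\overline{tc'}=\overline{ct'}$ with $\overline v,\overline{t'}\in\overline{\mathcal S}$; * $\widetilde{\mathfrak s}([t\backslash\delta/s])=[QA\xrightarrow{Q(xs)}QY\xrightarrow{Q(ty)}QC]$ if $\mathfrak s(\delta)=[X\xrightarrow{x}Y\xrightarrow{y}Z]$; * $\mu(\delta)=[\mathrm{id}\backslash\delta/\mathrm{id}]$. **Corollary 3.6.** Let $(F,\phi)\colon(\mathcal C,\mathbb E,\mathfrak s)\to(\mathcal D,\mathbb F,\mathfrak t)$ be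 an exact functor from an extriangulated category, with $\mathcal C$ small, to a weakly extriangulated category, and let $\mathcal S=F^{-1}(\mathrm{Iso}(\mathcal D))$ be the class of morphisms of $\mathcal C$ that $F$ sends to isomorphisms. If $\mathcal S$ is a multiplicative system in $\mathcal C$, or more generally if $\overline{\mathcal S}$ is a multiplicative system in $\overline{\mathcal C}$, then the exact localization $(Q,\mu)\colon(\mathcal C,\mathbb E,\mathfrak s)\to(\widetilde{\mathcal C},\widetilde{\mathbb E},\widetilde{\mathfrak s})$ by $\mathcal S$ exists, and there is a unique exact functor $(\widetilde F,\widetilde\phi)\colon(\widetilde{\mathcal C},\widetilde{\mathbb E},\widetilde{\mathfrak s})\to(\mathcal D,\mathbb F,\mathfrak t)$ such that $(F,\phi)=(\widetilde F,\widetilde\phi)\circ(Q,\mu)$. -/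

import Mathlib

open CategoryTheory CategoryTheory.Limits Opposite

universe w w' w'' v v' v'' u u' u''

namespace ExtriLoc

/-! ### Sequences, extensions and realizations -/

section Basic

variable {C : Type u} [Category.{v} C]

/-- A sequence `A ⟶ B ⟶ D` with fixed end terms `A` and `D`. -/
structure ShortSeq (A D : C) where
  mid : C
  x : A ⟶ mid
  y : mid ⟶ D

/-- Two sequences with the same end terms are equivalent if there is an isomorphism of the middle
terms compatible with the identities of the end terms. -/
def ShortSeq.Equiv {A D : C} (p q : ShortSeq A D) : Prop :=
  ∃ b : p.mid ≅ q.mid, p.x ≫ b.hom = q.x ∧ b.hom ≫ q.y = p.y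

/-- Equivalence of sequences, as a setoid. -/
def shortSeqSetoid (A D : C) : Setoid (ShortSeq A D) where
  r := ShortSeq.Equiv
  iseqv :=
    { refl := fun p => ⟨Iso.refl _, by simp, by simp⟩
      symm := by
        rintro p q ⟨b, h1, h2⟩
        exact ⟨b.symm, by simp [← h1], by simp [← h2]⟩
      trans := by
        rintro p q r ⟨b, h1, h2⟩ ⟨c, h3, h4⟩
        exact ⟨b.trans c, by simp [← h3, ← h1], by simp [← h2, h4]⟩ }

/-- Equivalence classes of sequences `A ⟶ B ⟶ D`. -/
abbrev SeqClass (A D : C) := Quotient (shortSeqSetoid A D)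

/-- The equivalence class `[A ⟶ B ⟶ D]`. -/
def seqClass {A B D : C} (x : A ⟶ B) (y : B ⟶ D) : SeqClass A D :=
  Quotient.mk (shortSeqSetoid A D) ⟨B, x, y⟩

/-- A biadditive functor `𝔼 : Cᵒᵖ × C ⥤ Ab` (in curried form) with a map assigning to each element
`δ ∈ 𝔼(D, A)` an equivalence class of sequences `A ⟶ B ⟶ D`. -/
structure ExtStructure (C : Type u) [Category.{v} C] [Preadditive C] where
  E : Cᵒᵖ ⥤ C ⥤ AddCommGrpCat.{w}
  additive_left : E.Additive
  additive_right : ∀ D : Cᵒᵖ, (E.obj D).Additive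
  real : ∀ {D A : C}, ((E.obj (op D)).obj A) → SeqClass A D

namespace ExtStructure

variable {pC : Preadditive C} (X : ExtStructure.{w} C)

/-- The abelian group `𝔼(D, A)` of extensions. -/
abbrev Ext (D A : C) : Type w := (X.E.obj (op D)).obj A

variable {X}

/-- `a_* δ = 𝔼(D, a)(δ)`. -/
def push {D A A' : C} (a : A ⟶ A') (δ : X.Ext D A) : X.Ext D A' :=
  ((X.E.obj (op D)).map a).hom δ

/-- `c^* δ = 𝔼(c, A)(δ)`. -/
def pull {D D' A : C} (c : D' ⟶ D) (δ : X.Ext D A) : X.Ext D' A :=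
  ((X.E.map c.op).app A).hom δ

variable (X)

/-- `A ⟶ B ⟶ D` together with `δ ∈ 𝔼(D, A)` is an `𝔰`-triangle: `𝔰(δ) = [A ⟶ B ⟶ D]`. -/
def IsTriangle {A B D : C} (x : A ⟶ B) (y : B ⟶ D) (δ : X.Ext D A) : Prop :=
  X.real δ = seqClass x y

/-- `𝔰`-inflations. -/
def IsInflation {A B : C} (x : A ⟶ B) : Prop :=
  ∃ (D : C) (y : B ⟶ D) (δ : X.Ext D A), X.IsTriangle x y δ

/-- `𝔰`-deflations. -/
def IsDeflation {B D : C} (y : B ⟶ D) : Prop :=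
  ∃ (A : C) (x : A ⟶ B) (δ : X.Ext D A), X.IsTriangle x y δ

/-- Weakly extriangulated categories: each `𝔰`-triangle induces exact sequences of Hom and `𝔼`, the
trivial sequences realize zero, and (co)base changes of triangles have mapping cone triangles. -/
structure IsWeaklyExtriangulated [HasBinaryBiproducts C] : Prop where
  c1_mid : ∀ {A B D : C} (x : A ⟶ B) (y : B ⟶ D) (δ : X.Ext D A), X.IsTriangle x y δ →
    ∀ T : C, Function.Exact (fun f : T ⟶ A => f ≫ x) (fun f : T ⟶ B => f ≫ y)
  c1_right : ∀ {A B D : C} (x : A ⟶ B) (y : B ⟶ D) (δ : X.Ext D A), X.IsTriangle x y δ →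
    ∀ T : C, Function.Exact (fun f : T ⟶ B => f ≫ y) (fun f : T ⟶ D => pull f δ)
  c1op_mid : ∀ {A B D : C} (x : A ⟶ B) (y : B ⟶ D) (δ : X.Ext D A), X.IsTriangle x y δ →
    ∀ T : C, Function.Exact (fun f : D ⟶ T => y ≫ f) (fun f : B ⟶ T => x ≫ f)
  c1op_left : ∀ {A B D : C} (x : A ⟶ B) (y : B ⟶ D) (δ : X.Ext D A), X.IsTriangle x y δ →
    ∀ T : C, Function.Exact (fun f : B ⟶ T => x ≫ f) (fun f : A ⟶ T => push f δ)
  c2 : ∀ (A Z : C), IsZero Z → X.IsTriangle (𝟙 A) (0 : A ⟶ Z) 0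
  c2op : ∀ (A Z : C), IsZero Z → X.IsTriangle (0 : Z ⟶ A) (𝟙 A) 0
  c3 : ∀ {A A' B B' D : C} (x : A ⟶ B) (y : B ⟶ D) (δ : X.Ext D A) (a : A ⟶ A')
    (x' : A' ⟶ B') (y' : B' ⟶ D), X.IsTriangle x y δ → X.IsTriangle x' y' (push a δ) →
    ∃ b : B ⟶ B', x ≫ b = a ≫ x' ∧ b ≫ y' = y ∧
      X.IsTriangle (biprod.lift x a) (biprod.desc b (-x')) (pull y' δ)
  c3op : ∀ {A B B' D D' : C} (x : A ⟶ B) (y : B ⟶ D) (δ : X.Ext D A) (c : D' ⟶ D)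
    (x' : A ⟶ B') (y' : B' ⟶ D'), X.IsTriangle x y δ → X.IsTriangle x' y' (pull c δ) →
    ∃ b : B' ⟶ B, x' ≫ b = x ∧ b ≫ y = y' ≫ c ∧
      X.IsTriangle (biprod.lift (-y') b) (biprod.desc c y) (push x' δ)

/-- Extriangulated categories: moreover inflations, and deflations, are closed under composition. -/
structure IsExtriangulated [HasBinaryBiproducts C] : Prop extends
    X.IsWeaklyExtriangulated where
  c4 : ∀ {A A' A'' : C} (f : A ⟶ A') (f' : A' ⟶ A''),
    X.IsInflation f → X.IsInflation f' → X.IsInflation (f ≫ f')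
  c4op : ∀ {A A' A'' : C} (f : A ⟶ A') (f' : A' ⟶ A''),
    X.IsDeflation f → X.IsDeflation f' → X.IsDeflation (f ≫ f')

end ExtStructure

end Basic

/-! ### Exact functors -/

section ExactFunctors

open ExtStructure

variable {C : Type u} [Category.{v} C] {pC : Preadditive C}
  {D : Type u'} [Category.{v'} D] {pD : Preadditive D}
  {B : Type u''} [Category.{v''} B] {pB : Preadditive B}

/-- A natural transformation `φ : 𝔼 ⟹ 𝔽 ∘ (Fᵒᵖ × F)` of functors to abelian groups. The components
are spelled out because the abelian groups on the two sides may live in different universes. -/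
@[ext]
structure ExtTrans (X : ExtStructure.{w} C) (Y : ExtStructure.{w'} D) (F : C ⥤ D) where
  app : ∀ K A : C, X.Ext K A →+ Y.Ext (F.obj K) (F.obj A)
  push_app : ∀ {K A A' : C} (a : A ⟶ A') (δ : X.Ext K A),
    app K A' (push a δ) = push (F.map a) (app K A δ)
  pull_app : ∀ {K K' A : C} (c : K' ⟶ K) (δ : X.Ext K A),
    app K' A (pull c δ) = pull (F.map c) (app K A δ)

/-- The condition `𝔱(φ(δ)) = [F A ⟶ F B ⟶ F K]` for each `𝔰`-triangle `A ⟶ B ⟶ K`, `δ`. -/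
def ExtTrans.PreservesTriangles {X : ExtStructure.{w} C} {Y : ExtStructure.{w'} D} {F : C ⥤ D}
    (φ : ExtTrans X Y F) : Prop :=
  ∀ {A B K : C} (x : A ⟶ B) (y : B ⟶ K) (δ : X.Ext K A), X.IsTriangle x y δ →
    Y.IsTriangle (F.map x) (F.map y) (φ.app K A δ)

/-- An exact functor `(F, φ)`. -/
structure ExactFunctor (X : ExtStructure.{w} C) (Y : ExtStructure.{w'} D) where
  F : C ⥤ D
  additive : F.Additive
  φ : ExtTrans X Y F
  preserves : φ.PreservesTriangles

/-- The composition `(G, ψ) ∘ (F, φ) = (G ∘ F, (ψ ∘ (Fᵒᵖ × F)) · φ)`. -/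
def ExactFunctor.comp {X : ExtStructure.{w} C} {Y : ExtStructure.{w'} D} {Z : ExtStructure.{w''} B}
    (H : ExactFunctor X Y) (G : ExactFunctor Y Z) : ExactFunctor X Z where
  F := H.F ⋙ G.F
  additive :=
    haveI := H.additive
    haveI := G.additive
    inferInstance
  φ :=
    { app := fun K A => (G.φ.app (H.F.obj K) (H.F.obj A)).comp (H.φ.app K A)
      push_app := fun a δ => by
        simp only [AddMonoidHom.comp_apply, H.φ.push_app, G.φ.push_app, Functor.comp_map]
      pull_app := fun c δ => by
        simp only [AddMonoidHom.comp_apply, H.φ.pull_app, G.φ.pull_app, Functor.comp_map] }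
  preserves := fun x y δ h => G.preserves _ _ _ (H.preserves x y δ h)

end ExactFunctors

/-! ### The ideal quotient `C / [N_S]` and the class `S̄` -/

section Quotient

variable {C : Type u} [Category.{v} C] [Preadditive C]

/-- The objects `N` of the full subcategory `N_S`: both `N ⟶ 0` and `0 ⟶ N` belong to `S`. -/
def nullObj (S : MorphismProperty C) (N : C) : Prop :=
  ∀ Z : C, IsZero Z → S (0 : N ⟶ Z) ∧ S (0 : Z ⟶ N)

/-- Two parallel morphisms are identified in the ideal quotient if their difference factors through
an object of `N_S`. -/
def idealRel (S : MorphismProperty C) : HomRel C :=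
  fun A B f g => ∃ (N : C) (_ : nullObj S N) (i : A ⟶ N) (j : N ⟶ B), g = f + i ≫ j

/-- The ideal quotient `C̄ = C / [N_S]`. -/
abbrev IdealQuot (S : MorphismProperty C) := CategoryTheory.Quotient (idealRel S)

/-- The quotient functor `p : C ⥤ C̄`. -/
abbrev quotFunctor (S : MorphismProperty C) : C ⥤ IdealQuot S :=
  CategoryTheory.Quotient.functor (idealRel S)

/-- The class `S̄`: the closure of `p(S)` under composition with isomorphisms of `C̄`, that is, the
smallest class which contains `p(S)` and all isomorphisms and is closed under composition. -/
inductive sBar (S : MorphismProperty C) : MorphismProperty (IdealQuot S)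
  | of_mem {A B : C} (f : A ⟶ B) (hf : S f) : sBar S ((quotFunctor S).map f)
  | of_isIso {A B : IdealQuot S} (f : A ⟶ B) (hf : IsIso f) : sBar S f
  | comp {A B K : IdealQuot S} (f : A ⟶ B) (g : B ⟶ K) (hf : sBar S f) (hg : sBar S g) :
      sBar S (f ≫ g)

/-- The saturation `p⁻¹(S̄)`: the morphisms `s` of `C` whose class `s̄` belongs to `S̄`. -/
def sSat (S : MorphismProperty C) : MorphismProperty C :=
  (sBar S).inverseImage (quotFunctor S)

/-- A multiplicative system: both a left and a right calculus of fractions. -/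
def IsMultiplicativeSystem {K : Type u'} [Category.{v'} K] (W : MorphismProperty K) : Prop :=
  W.HasLeftCalculusOfFractions ∧ W.HasRightCalculusOfFractions

end Quotient

/-! ### The exact localization -/

section Localization

open ExtStructure

variable {C : Type u} [Category.{v} C] {pC : Preadditive C}

/-- The subset `𝒦(K, A) ⊆ 𝔼(K, A)` of extensions killed by a morphism in `S`. -/
def killed (X : ExtStructure.{w} C) (S : MorphismProperty C) {K A : C} (δ : X.Ext K A) : Prop :=
  ∃ (A' : C) (s : A ⟶ A'), sSat S s ∧ push s δ = 0

/-- Triplets `(t \ δ / s) = (K ⟵t- Z -δ⇢ Y ⟵s- A)` with `s̄, t̄ ∈ S̄` and `δ ∈ 𝔼(Z, Y)`. -/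
structure Triplet (X : ExtStructure.{w} C) (S : MorphismProperty C) (K A : C) where
  {Z : C}
  {Y : C}
  t : Z ⟶ K
  ht : sSat S t
  δ : X.Ext Z Y
  s : A ⟶ Y
  hs : sSat S s

/-- The relation `∼` on triplets: for some common denominator `s̄ = ū₁ s̄₁ = ū₂ s̄₂`,
`t̄ = t̄₁ v̄₁ = t̄₂ v̄₂`, with all morphisms in `S̄`, the classes of `v₁^* u₁_* δ₁` and `v₂^* u₂_* δ₂`
in `𝔼 / 𝒦` agree. Equalities of morphisms are required in `C̄` only. -/
def Triplet.Rel {X : ExtStructure.{w} C} {S : MorphismProperty C} {K A : C}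
    (a b : Triplet X S K A) : Prop :=
  ∃ (Z Y : C) (t : Z ⟶ K) (s : A ⟶ Y)
    (v₁ : Z ⟶ a.Z) (v₂ : Z ⟶ b.Z) (u₁ : a.Y ⟶ Y) (u₂ : b.Y ⟶ Y),
    sSat S t ∧ sSat S s ∧ sSat S v₁ ∧ sSat S v₂ ∧ sSat S u₁ ∧ sSat S u₂ ∧
    (quotFunctor S).map s = (quotFunctor S).map (a.s ≫ u₁) ∧
    (quotFunctor S).map s = (quotFunctor S).map (b.s ≫ u₂) ∧
    (quotFunctor S).map t = (quotFunctor S).map (v₁ ≫ a.t) ∧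
    (quotFunctor S).map t = (quotFunctor S).map (v₂ ≫ b.t) ∧
    killed X S (pull v₁ (push u₁ a.δ) - pull v₂ (push u₂ b.δ))

/-- The set of equivalence classes `[t \ δ / s]` of triplets. -/
def TripletClass (X : ExtStructure.{w} C) (S : MorphismProperty C) (K A : C) :=
  Quot (Triplet.Rel (X := X) (S := S) (K := K) (A := A))

/-- The class `[t \ δ / s]`. -/
def tripletClass {X : ExtStructure.{w} C} {S : MorphismProperty C} {K A Z Y : C} (t : Z ⟶ K)
    (ht : sSat S t) (δ : X.Ext Z Y) (s : A ⟶ Y) (hs : sSat S s) : TripletClass X S K A :=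
  Quot.mk _ ⟨t, ht, δ, s, hs⟩

/-- Identities belong to `p⁻¹(S̄)`. -/
lemma sSat_id (S : MorphismProperty C) (A : C) : sSat S (𝟙 A) :=
  sBar.of_isIso _ (by rw [CategoryTheory.Functor.map_id]; infer_instance)

/-- `p⁻¹(S̄)` is closed under composition. -/
lemma sSat_comp (S : MorphismProperty C) {A B K : C} (f : A ⟶ B) (g : B ⟶ K)
    (hf : sSat S f) (hg : sSat S g) : sSat S (f ≫ g) := by
  have h := sBar.comp _ _ hf hg
  rw [← Functor.map_comp] at h
  exact h

/-- The exact localization `(Q, μ) : (C, 𝔼, 𝔰) ⟶ (C̃, 𝔼̃, 𝔰̃)` by `S`. Here `C̃ = S.Localization` with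
its localization functor `Q = S.Q`, the set `𝔼̃(K, A)` is identified with the set of classes
`[t \ δ / s]` of triplets, and the group structure, the functoriality, the realization `𝔰̃` and
the natural transformation `μ` are given by the explicit formulas below. All of this determines the
structure on `C̃` up to the identification `frac`; every object of `C̃` is of the form `Q K`. -/
structure ExactLocalization (X : ExtStructure.{w} C) (S : MorphismProperty C) where
  /-- the additive structure of `C̃`, for which `Q` is additive -/
  [preadditive : Preadditive S.Localization]
  [hasZeroObject : HasZeroObject S.Localization]
  [hasBinaryBiproducts : HasBinaryBiproducts S.Localization]
  Q_additive : S.Q.Additive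
  /-- `𝔼̃` and `𝔰̃` -/
  str : ExtStructure.{max u v w} S.Localization
  weak : str.IsWeaklyExtriangulated
  /-- `𝔼̃(K, A)` is the set of classes of triplets -/
  frac : ∀ K A : C, TripletClass X S K A ≃ str.Ext (S.Q.obj K) (S.Q.obj A)
  /-- `[t \ δ₁ / s] + [t \ δ₂ / s] = [t \ δ₁ + δ₂ / s]` -/
  frac_add : ∀ {K A Z Y : C} (t : Z ⟶ K) (ht : sSat S t) (δ₁ δ₂ : X.Ext Z Y) (s : A ⟶ Y)
    (hs : sSat S s),
    frac K A (tripletClass t ht (δ₁ + δ₂) s hs) =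
      frac K A (tripletClass t ht δ₁ s hs) + frac K A (tripletClass t ht δ₂ s hs)
  /-- `α_* [t \ δ / s] = [t \ a'_* δ / s' u]` where `α = Q(u)⁻¹ Q(a)` and `ā' s̄ = s̄' ā` -/
  push_frac : ∀ {K A A' Z Y G Y' : C} (t : Z ⟶ K) (ht : sSat S t) (δ : X.Ext Z Y) (s : A ⟶ Y)
    (hs : sSat S s) (α : S.Q.obj A ⟶ S.Q.obj A') (a : A ⟶ G) (u : A' ⟶ G) (hu : sSat S u)
    (_ : α ≫ S.Q.map u = S.Q.map a) (a' : Y ⟶ Y') (s' : G ⟶ Y') (hs' : sSat S s')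
    (_ : (quotFunctor S).map (s ≫ a') = (quotFunctor S).map (a ≫ s')),
    push α (frac K A (tripletClass t ht δ s hs)) =
      frac K A' (tripletClass t ht (push a' δ) (u ≫ s') (sSat_comp S u s' hu hs'))
  /-- `γ^* [t \ δ / s] = [v t' \ c'^* δ / s]` where `γ = Q(c) Q(v)⁻¹` and `t̄ c̄' = c̄ t̄'` -/
  pull_frac : ∀ {K K' A Z Y G Z' : C} (t : Z ⟶ K) (ht : sSat S t) (δ : X.Ext Z Y) (s : A ⟶ Y)
    (hs : sSat S s) (γ : S.Q.obj K' ⟶ S.Q.obj K) (c : G ⟶ K) (v : G ⟶ K') (hv : sSat S v)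
    (_ : S.Q.map v ≫ γ = S.Q.map c) (c' : Z' ⟶ Z) (t' : Z' ⟶ G) (ht' : sSat S t')
    (_ : (quotFunctor S).map (c' ≫ t) = (quotFunctor S).map (t' ≫ c)),
    pull γ (frac K A (tripletClass t ht δ s hs)) =
      frac K' A (tripletClass (t' ≫ v) (sSat_comp S t' v ht' hv) (pull c' δ) s hs)
  /-- `𝔰̃([t \ δ / s]) = [Q A ⟶ Q B ⟶ Q K]`, with maps `Q(x s)` and `Q(t y)`, for
  `𝔰(δ) = [Y -x⟶ B -y⟶ Z]` -/
  real_frac : ∀ {K A Z Y B : C} (t : Z ⟶ K) (ht : sSat S t) (δ : X.Ext Z Y) (s : A ⟶ Y)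
    (hs : sSat S s) (x : Y ⟶ B) (y : B ⟶ Z), X.IsTriangle x y δ →
    str.real (frac K A (tripletClass t ht δ s hs)) =
      seqClass (S.Q.map (s ≫ x)) (S.Q.map (y ≫ t))
  /-- the natural transformation `μ : 𝔼 ⟹ 𝔼̃ ∘ (Qᵒᵖ × Q)`, `μ(δ) = [id \ δ / id]` -/
  μ : ExtTrans X str S.Q
  μ_app : ∀ {K A : C} (δ : X.Ext K A),
    μ.app K A δ = frac K A (tripletClass (𝟙 K) (sSat_id S K) δ (𝟙 A) (sSat_id S A))
  μ_preserves : μ.PreservesTriangles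

/-- The exact functor `(Q, μ)`. -/
def ExactLocalization.functor {X : ExtStructure.{w} C} {S : MorphismProperty C}
    (L : ExactLocalization X S) : ExactFunctor X L.str where
  F := S.Q
  additive := L.Q_additive
  φ := L.μ
  preserves := L.μ_preserves

end Localization

end ExtriLoc

namespace ExtriLoc

set_option linter.unusedSectionVars false

namespace ExtStructure

section Bifunctor

variable {C : Type u} [Category.{v} C] {pC : Preadditive C} {X : ExtStructure.{w} C}

@[simp]
lemma push_id {K A : C} (δ : X.Ext K A) : push (𝟙 A) δ = δ := by
  simp [push]

lemma push_comp {K A A' A'' : C} (a : A ⟶ A') (a' : A' ⟶ A'') (δ : X.Ext K A) :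
    push (a ≫ a') δ = push a' (push a δ) := by
  simp [push]

@[simp]
lemma pull_id {K A : C} (δ : X.Ext K A) : pull (𝟙 K) δ = δ := by
  simp [pull]

lemma pull_comp {K K' K'' A : C} (c : K' ⟶ K) (c' : K'' ⟶ K') (δ : X.Ext K A) :
    pull (c' ≫ c) δ = pull c' (pull c δ) := by
  simp [pull]

@[simp]
lemma push_zero {K A A' : C} (a : A ⟶ A') : push a (0 : X.Ext K A) = 0 :=
  map_zero ((X.E.obj (op K)).map a).hom

@[simp]
lemma pull_zero {K K' A : C} (c : K' ⟶ K) : pull c (0 : X.Ext K A) = 0 :=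
  map_zero ((X.E.map c.op).app A).hom

lemma push_add {K A A' : C} (a : A ⟶ A') (δ δ' : X.Ext K A) :
    push a (δ + δ') = push a δ + push a δ' :=
  map_add ((X.E.obj (op K)).map a).hom δ δ'

lemma push_sub {K A A' : C} (a : A ⟶ A') (δ δ' : X.Ext K A) :
    push a (δ - δ') = push a δ - push a δ' :=
  map_sub ((X.E.obj (op K)).map a).hom δ δ'

lemma pull_add {K K' A : C} (c : K' ⟶ K) (δ δ' : X.Ext K A) :
    pull c (δ + δ') = pull c δ + pull c δ' :=
  map_add ((X.E.map c.op).app A).hom δ δ'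

lemma pull_sub {K K' A : C} (c : K' ⟶ K) (δ δ' : X.Ext K A) :
    pull c (δ - δ') = pull c δ - pull c δ' :=
  map_sub ((X.E.map c.op).app A).hom δ δ'

lemma pull_push {K K' A A' : C} (c : K' ⟶ K) (a : A ⟶ A') (δ : X.Ext K A) :
    pull c (push a δ) = push a (pull c δ) := by
  simp [push, pull]

lemma add_push {K A A' : C} (a a' : A ⟶ A') (δ : X.Ext K A) :
    push (a + a') δ = push a δ + push a' δ := by
  have := X.additive_right (op K)
  have := (X.E.obj (op K)).map_add (f := a) (g := a')
  simp only [push, this]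
  rfl

lemma add_pull {K K' A : C} (c c' : K' ⟶ K) (δ : X.Ext K A) :
    pull (c + c') δ = pull c δ + pull c' δ := by
  have := X.additive_left
  have := X.E.map_add (f := c.op) (g := c'.op)
  simp only [pull, op_add, this]
  rfl

@[simp]
lemma zero_push {K A A' : C} (δ : X.Ext K A) : push (0 : A ⟶ A') δ = 0 := by
  have := add_push (0 : A ⟶ A') 0 δ
  simpa using this

@[simp]
lemma zero_pull {K K' A : C} (δ : X.Ext K A) : pull (0 : K' ⟶ K) δ = 0 := by
  have := add_pull (0 : K' ⟶ K) 0 δ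
  simpa using this

lemma push_injective_of_isIso {K A A' : C} (a : A ⟶ A') [IsIso a] :
    Function.Injective (push a : X.Ext K A → X.Ext K A') := by
  intro δ δ' h
  simpa [← push_comp] using congrArg (push (inv a)) h

lemma pull_injective_of_isIso {K K' A : C} (c : K' ⟶ K) [IsIso c] :
    Function.Injective (pull c : X.Ext K A → X.Ext K' A) := by
  intro δ δ' h
  simpa [← pull_comp] using congrArg (pull (inv c)) h

lemma push_comp_eq_zero {K A A' A'' : C} (a : A ⟶ A') (a' : A' ⟶ A'') (δ : X.Ext K A)
    (h : push a δ = 0) : push (a ≫ a') δ = 0 := by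
  rw [push_comp, h, push_zero]

end Bifunctor

section Triangles

variable {C : Type u} [Category.{v} C] {pC : Preadditive C} {X : ExtStructure.{w} C}

lemma exists_isTriangle {K A : C} (δ : X.Ext K A) :
    ∃ (B : C) (x : A ⟶ B) (y : B ⟶ K), X.IsTriangle x y δ := by
  obtain ⟨⟨B, x, y⟩, h⟩ := Quotient.exists_rep (X.real δ)
  exact ⟨B, x, y, h.symm⟩

lemma seqClass_eq_iff {A B B' K : C} (x : A ⟶ B) (y : B ⟶ K) (x' : A ⟶ B') (y' : B' ⟶ K) :
    seqClass x y = seqClass x' y' ↔ ∃ b : B ≅ B', x ≫ b.hom = x' ∧ b.hom ≫ y' = y :=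
  Quotient.eq (r := shortSeqSetoid A K)

lemma IsTriangle.of_iso_mid {A B B' K : C} {x : A ⟶ B} {y : B ⟶ K} {x' : A ⟶ B'} {y' : B' ⟶ K}
    {δ : X.Ext K A} (h : X.IsTriangle x y δ) (b : B ≅ B') (hx : x ≫ b.hom = x')
    (hy : b.hom ≫ y' = y) : X.IsTriangle x' y' δ :=
  h.trans ((seqClass_eq_iff _ _ _ _).2 ⟨b, hx, hy⟩)

end Triangles

namespace IsWeaklyExtriangulated

variable {C : Type u} [Category.{v} C] {pC : Preadditive C} [HasBinaryBiproducts C]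
  {X : ExtStructure.{w} C} (hX : X.IsWeaklyExtriangulated)
include hX

section

variable {A B K : C} {x : A ⟶ B} {y : B ⟶ K} {δ : X.Ext K A} (h : X.IsTriangle x y δ)
include h

lemma comp_eq_zero : x ≫ y = 0 :=
  (hX.c1_mid x y δ h A x).2 ⟨𝟙 A, by simp⟩

lemma pull_eq_zero : pull y δ = 0 :=
  (hX.c1_right x y δ h B y).2 ⟨𝟙 B, by simp⟩

lemma push_eq_zero : push x δ = 0 :=
  (hX.c1op_left x y δ h B x).2 ⟨𝟙 B, by simp⟩

lemma exists_lift_x {T : C} (f : T ⟶ B) (hf : f ≫ y = 0) : ∃ g : T ⟶ A, g ≫ x = f :=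
  (hX.c1_mid x y δ h T f).1 hf

lemma exists_lift_y {T : C} (f : T ⟶ K) (hf : pull f δ = 0) : ∃ g : T ⟶ B, g ≫ y = f :=
  (hX.c1_right x y δ h T f).1 hf

lemma exists_desc_y {T : C} (f : B ⟶ T) (hf : x ≫ f = 0) : ∃ g : K ⟶ T, y ≫ g = f :=
  (hX.c1op_mid x y δ h T f).1 hf

lemma exists_desc_x {T : C} (f : A ⟶ T) (hf : push f δ = 0) : ∃ g : B ⟶ T, x ≫ g = f :=
  (hX.c1op_left x y δ h T f).1 hf

end

section

variable {A B K A' B' K' : C} {x : A ⟶ B} {y : B ⟶ K} {δ : X.Ext K A} {x' : A' ⟶ B'}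
  {y' : B' ⟶ K'} {δ' : X.Ext K' A'} (h : X.IsTriangle x y δ) (h' : X.IsTriangle x' y' δ')
include h h'

/-- A morphism of extensions extends to a morphism of triangles. -/
lemma exists_hom (a : A ⟶ A') (c : K ⟶ K') (hac : push a δ = pull c δ') :
    ∃ b : B ⟶ B', x ≫ b = a ≫ x' ∧ b ≫ y' = y ≫ c := by
  obtain ⟨E, x₁, y₁, h₁⟩ := exists_isTriangle (push a δ)
  obtain ⟨b₁, h₂, h₃, -⟩ := hX.c3 x y δ a x₁ y₁ h h₁
  obtain ⟨b₂, h₄, h₅, -⟩ := hX.c3op x' y' δ' c x₁ y₁ h' (hac ▸ h₁)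
  exact ⟨b₁ ≫ b₂, by rw [reassoc_of% h₂, h₄], by rw [Category.assoc, h₅, reassoc_of% h₃]⟩

lemma isIso_mid (a : A ⟶ A') (b : B ⟶ B') (c : K ⟶ K') [IsIso a] [IsIso c]
    (hac : push a δ = pull c δ') (hab : x ≫ b = a ≫ x') (hbc : b ≫ y' = y ≫ c) : IsIso b := by
  obtain ⟨r, hr⟩ : ∃ r : B' ⟶ B, r ≫ b = 𝟙 B' := by
    obtain ⟨f, hf⟩ := hX.exists_lift_y h (y' ≫ inv c) (by
      apply push_injective_of_isIso a
      rw [push_zero, ← pull_push, hac, ← pull_comp]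
      simpa using hX.pull_eq_zero h')
    obtain ⟨g, hg⟩ := hX.exists_lift_x h' (𝟙 B' - f ≫ b) (by
      simp [Preadditive.sub_comp, hbc, reassoc_of% hf])
    exact ⟨f + g ≫ inv a ≫ x, by simp [Preadditive.add_comp, hab, hg]⟩
  obtain ⟨l, hl⟩ : ∃ l : B' ⟶ B, b ≫ l = 𝟙 B := by
    obtain ⟨f, hf⟩ := hX.exists_desc_x h' (inv a ≫ x) (by
      apply pull_injective_of_isIso c
      rw [pull_zero, pull_push, ← hac, ← push_comp]
      simpa using hX.push_eq_zero h)
    obtain ⟨g, hg⟩ := hX.exists_desc_y h (𝟙 B - b ≫ f) (by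
      simp [Preadditive.comp_sub, reassoc_of% hab, hf])
    exact ⟨f + y' ≫ inv c ≫ g, by simp [Preadditive.comp_add, reassoc_of% hbc, hg]⟩
  exact ⟨l, hl, by rw [← hr, ← Category.comp_id r, ← hl]; simp [reassoc_of% hr]⟩

end

/-- Triangles are closed under isomorphisms. -/
lemma isTriangle_of_iso {A B K A' B' K' : C} {x : A ⟶ B} {y : B ⟶ K} {δ : X.Ext K A}
    (h : X.IsTriangle x y δ) {x' : A' ⟶ B'} {y' : B' ⟶ K'} {δ' : X.Ext K' A'}
    (a : A ⟶ A') (b : B ⟶ B') (c : K ⟶ K') [IsIso a] [IsIso b] [IsIso c]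
    (hac : push a δ = pull c δ') (hab : x ≫ b = a ≫ x') (hbc : b ≫ y' = y ≫ c) :
    X.IsTriangle x' y' δ' := by
  obtain ⟨E, x₁, y₁, h₁⟩ := exists_isTriangle δ'
  obtain ⟨b₁, h₂, h₃⟩ := hX.exists_hom h h₁ a c hac
  have := hX.isIso_mid h h₁ a b₁ c hac h₂ h₃
  refine h₁.of_iso_mid ((asIso b₁).symm.trans (asIso b)) ?_ ?_
  · simp [← cancel_epi a, ← reassoc_of% h₂, hab]
  · simp [hbc, ← h₃]

end IsWeaklyExtriangulated

end ExtStructure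

/-! ### The quotient category and the localization -/

/-- The class `S` consists of the morphisms inverted by its localization functor, the ideal
quotient by its null objects is a preadditive category, and its image in there is a multiplicative
system with the same localization. -/
structure HasQuotientCalculus {C : Type u} [Category.{v} C] [Preadditive C]
    (S : MorphismProperty C) : Prop where
  congruence : Congruence (idealRel S)
  add : ∀ ⦃A B : C⦄ (f₁ f₂ g₁ g₂ : A ⟶ B), idealRel S f₁ f₂ → idealRel S g₁ g₂ →
    idealRel S (f₁ + g₁) (f₂ + g₂)
  iff_isIso : ∀ {A B : C} (f : A ⟶ B), S f ↔ IsIso (S.Q.map f)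
  map_eq : ∀ (A B : C) (f g : A ⟶ B), idealRel S f g → S.Q.map f = S.Q.map g
  mult : IsMultiplicativeSystem (sBar S)

section InverseImage

open scoped ZeroObject

variable {C : Type u} [Category.{v} C] [Preadditive C] [HasZeroObject C] [HasBinaryBiproducts C]
  {D : Type u'} [Category.{v'} D] [Preadditive D]
  (F : C ⥤ D) [F.Additive] {S : MorphismProperty C}
  (hS : S = (MorphismProperty.isomorphisms D).inverseImage F)
include hS

lemma mem_iff_isIso_map {A B : C} (f : A ⟶ B) : S f ↔ IsIso (F.map f) := by
  subst hS; rfl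

lemma nullObj_iff (N : C) : nullObj S N ↔ IsZero (F.obj N) := by
  constructor
  · intro h
    have := (mem_iff_isIso_map F hS _).1 (h 0 (isZero_zero C)).1
    exact (F.map_isZero (isZero_zero C)).of_iso (asIso (F.map (0 : N ⟶ 0)))
  · intro h Z hZ
    have hZ' := F.map_isZero hZ
    exact ⟨(mem_iff_isIso_map F hS _).2 ⟨0, h.eq_of_src _ _, hZ'.eq_of_src _ _⟩,
      (mem_iff_isIso_map F hS _).2 ⟨0, hZ'.eq_of_src _ _, h.eq_of_src _ _⟩⟩

lemma nullObj_biprod {N N' : C} (hN : nullObj S N) (hN' : nullObj S N') : nullObj S (N ⊞ N') := by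
  rw [nullObj_iff F hS] at *
  rw [IsZero.iff_id_eq_zero] at *
  rw [← F.map_id, ← biprod.total, F.map_add, F.map_comp, F.map_comp,
    ← Category.id_comp (F.map biprod.inl), ← Category.id_comp (F.map biprod.inr), hN, hN']
  simp

lemma congruence_idealRel : Congruence (idealRel S) where
  equivalence {A B} :=
    { refl := fun f => ⟨0, (nullObj_iff F hS _).2 (F.map_isZero (isZero_zero C)), 0, 0, by simp⟩
      symm := by
        rintro f g ⟨N, hN, i, j, rfl⟩
        exact ⟨N, hN, i, -j, by simp⟩
      trans := by
        rintro f g h ⟨N, hN, i, j, rfl⟩ ⟨N', hN', i', j', rfl⟩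
        exact ⟨N ⊞ N', nullObj_biprod F hS hN hN', biprod.lift i i', biprod.desc j j',
          by simp [add_assoc]⟩ }
  comp_left := by
    rintro A B K f _ _ ⟨N, hN, i, j, rfl⟩
    exact ⟨N, hN, f ≫ i, j, by simp⟩
  comp_right := by
    rintro A B K _ _ f ⟨N, hN, i, j, rfl⟩
    exact ⟨N, hN, i, j ≫ f, by simp⟩

lemma idealRel_add {A B : C} (f₁ f₂ g₁ g₂ : A ⟶ B) (hf : idealRel S f₁ f₂)
    (hg : idealRel S g₁ g₂) : idealRel S (f₁ + g₁) (f₂ + g₂) := by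
  obtain ⟨N, hN, i, j, rfl⟩ := hf
  obtain ⟨N', hN', i', j', rfl⟩ := hg
  exact ⟨N ⊞ N', nullObj_biprod F hS hN hN', biprod.lift i i', biprod.desc j j', by simp; abel⟩

/-- Functors inverting `S` factor through the ideal quotient. -/
lemma map_eq_of_idealRel {E : Type*} [Category* E] (G : C ⥤ E) (hG : S.IsInvertedBy G) {A B : C}
    (f g : A ⟶ B) (h : idealRel S f g) : G.map f = G.map g := by
  obtain ⟨N, hN, i, j, rfl⟩ := h
  have hp : S (biprod.fst : A ⊞ N ⟶ A) := by
    rw [mem_iff_isIso_map F hS]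
    rw [nullObj_iff F hS] at hN
    refine ⟨F.map biprod.inl, ?_, by simp [← F.map_comp]⟩
    have : F.map (biprod.snd : A ⊞ N ⟶ N) = 0 := hN.eq_of_tgt _ _
    rw [← F.map_id, ← biprod.total, F.map_add, F.map_comp biprod.snd, this]
    simp
  have := hG _ hp
  have key : G.map (biprod.lift (𝟙 A) 0 : A ⟶ A ⊞ N) = G.map (biprod.lift (𝟙 A) i) := by
    rw [← cancel_mono (G.map biprod.fst), ← G.map_comp, ← G.map_comp]
    simp
  have := congrArg (· ≫ G.map (biprod.desc f j)) key
  simpa [← G.map_comp] using this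

lemma sSat_eq : sSat S = S := by
  ext A B f
  refine ⟨fun h => ?_, fun h => sBar.of_mem f h⟩
  have hF : S.IsInvertedBy F := fun A B f hf => (mem_iff_isIso_map F hS f).1 hf
  let G : IdealQuot S ⥤ D := CategoryTheory.Quotient.lift _ F
    fun A B f g h => map_eq_of_idealRel F hS F hF f g h
  have key : ∀ {A B : IdealQuot S} (g : A ⟶ B), sBar S g → IsIso (G.map g) := by
    intro A B g hg
    induction hg with
    | of_mem f hf => exact hF f hf
    | of_isIso f hf => infer_instance
    | comp f g _ _ hf hg => rw [G.map_comp]; infer_instance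
  exact (mem_iff_isIso_map F hS f).2 (key _ h)

lemma iff_isIso_Q_map {A B : C} (f : A ⟶ B) : S f ↔ IsIso (S.Q.map f) := by
  refine ⟨fun h => S.Q_inverts f h, fun h => ?_⟩
  have hF : S.IsInvertedBy F := fun A B f hf => (mem_iff_isIso_map F hS f).1 hf
  rw [mem_iff_isIso_map F hS]
  have := Functor.congr_hom (Localization.Construction.fac F hF).symm f
  rw [this]
  simp only [Functor.comp_map]
  infer_instance

lemma sBar_map_iff {A B : C} (f : A ⟶ B) : sBar S ((quotFunctor S).map f) ↔ S f :=
  iff_of_eq (congrFun (congrFun (congrFun (sSat_eq F hS) A) B) f)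

lemma isMultiplicativeSystem_sBar (h : IsMultiplicativeSystem S) :
    IsMultiplicativeSystem (sBar S) := by
  have hc := congruence_idealRel F hS
  have hmul : (sBar S).IsMultiplicative :=
    { id_mem := fun A => sBar.of_isIso _ inferInstance
      comp_mem := fun f g hf hg => sBar.comp f g hf hg }
  obtain ⟨hl, hr⟩ := h
  refine ⟨{ hmul with exists_leftFraction := ?_, ext := ?_ },
    { hmul with exists_rightFraction := ?_, ext := ?_ }⟩
  · rintro ⟨A⟩ ⟨B⟩ ⟨s, hs, f⟩
    rename_i K
    obtain ⟨K⟩ := K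
    obtain ⟨s, rfl⟩ := (quotFunctor S).map_surjective (X := K) (Y := A) s
    obtain ⟨f, rfl⟩ := (quotFunctor S).map_surjective (X := K) (Y := B) f
    obtain ⟨⟨g, t, ht⟩, e⟩ := hl.exists_leftFraction ⟨s, (sBar_map_iff F hS s).1 hs, f⟩
    refine ⟨⟨(quotFunctor S).map g, (quotFunctor S).map t, sBar.of_mem t ht⟩, ?_⟩
    dsimp only at e ⊢
    rw [← Functor.map_comp, ← Functor.map_comp, e]
  · rintro ⟨K⟩ ⟨A⟩ ⟨B⟩ f₁ f₂ s hs e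
    obtain ⟨s, rfl⟩ := (quotFunctor S).map_surjective (X := K) (Y := A) s
    obtain ⟨f₁, rfl⟩ := (quotFunctor S).map_surjective (X := A) (Y := B) f₁
    obtain ⟨f₂, rfl⟩ := (quotFunctor S).map_surjective (X := A) (Y := B) f₂
    rw [← Functor.map_comp, ← Functor.map_comp, Quotient.functor_map_eq_iff] at e
    obtain ⟨N, hN, i, j, e⟩ := e
    obtain ⟨⟨z, t, ht⟩, e'⟩ := hl.exists_leftFraction ⟨_, (hN 0 (isZero_zero C)).1, j⟩
    dsimp only at z t e'
    have hjt : j ≫ t = 0 := by rw [e', zero_comp]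
    obtain ⟨B', t', ht', e''⟩ := hl.ext (f₁ ≫ t) (f₂ ≫ t) s ((sBar_map_iff F hS s).1 hs) (by
      rw [← Category.assoc, ← Category.assoc, e, Preadditive.add_comp, Category.assoc i, hjt,
        comp_zero, add_zero])
    refine ⟨_, (quotFunctor S).map (t ≫ t'), sBar.of_mem _ (S.comp_mem _ _ ht ht'), ?_⟩
    rw [← Functor.map_comp, ← Functor.map_comp, ← Category.assoc, e'', Category.assoc]
  · rintro ⟨A⟩ ⟨B⟩ ⟨f, s, hs⟩
    rename_i K
    obtain ⟨K⟩ := K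
    obtain ⟨s, rfl⟩ := (quotFunctor S).map_surjective (X := B) (Y := K) s
    obtain ⟨f, rfl⟩ := (quotFunctor S).map_surjective (X := A) (Y := K) f
    obtain ⟨⟨t, ht, g⟩, e⟩ := hr.exists_rightFraction ⟨f, s, (sBar_map_iff F hS s).1 hs⟩
    refine ⟨⟨(quotFunctor S).map t, sBar.of_mem t ht, (quotFunctor S).map g⟩, ?_⟩
    dsimp only at e ⊢
    rw [← Functor.map_comp, ← Functor.map_comp, e]
  · rintro ⟨A⟩ ⟨B⟩ ⟨K⟩ f₁ f₂ s hs e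
    obtain ⟨s, rfl⟩ := (quotFunctor S).map_surjective (X := B) (Y := K) s
    obtain ⟨f₁, rfl⟩ := (quotFunctor S).map_surjective (X := A) (Y := B) f₁
    obtain ⟨f₂, rfl⟩ := (quotFunctor S).map_surjective (X := A) (Y := B) f₂
    rw [← Functor.map_comp, ← Functor.map_comp, Quotient.functor_map_eq_iff] at e
    obtain ⟨N, hN, i, j, e⟩ := e
    obtain ⟨⟨t, ht, z⟩, e'⟩ := hr.exists_rightFraction ⟨i, _, (hN 0 (isZero_zero C)).2⟩
    dsimp only at z t e'
    have hti : t ≫ i = 0 := by rw [e', comp_zero]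
    obtain ⟨A', t', ht', e''⟩ := hr.ext (t ≫ f₁) (t ≫ f₂) s ((sBar_map_iff F hS s).1 hs) (by
      rw [Category.assoc, Category.assoc, e, Preadditive.comp_add, reassoc_of% hti, zero_comp,
        add_zero])
    refine ⟨_, (quotFunctor S).map (t' ≫ t), sBar.of_mem _ (S.comp_mem _ _ ht' ht), ?_⟩
    rw [← Functor.map_comp, ← Functor.map_comp, Category.assoc, e'', Category.assoc]

lemma hasQuotientCalculus
    (h : IsMultiplicativeSystem S ∨ IsMultiplicativeSystem (sBar S)) :
    HasQuotientCalculus S where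
  congruence := congruence_idealRel F hS
  add _ _ := idealRel_add F hS
  iff_isIso := iff_isIso_Q_map F hS
  map_eq _ _ := map_eq_of_idealRel F hS S.Q S.Q_inverts
  mult := h.elim (isMultiplicativeSystem_sBar F hS) id

end InverseImage

namespace HasQuotientCalculus

section Calculus

variable {C : Type u} [Category.{v} C] {pC : Preadditive C} {S : MorphismProperty C}

/-- The functor from the ideal quotient to the localization. -/
noncomputable def Qbar (h : HasQuotientCalculus S) : IdealQuot S ⥤ S.Localization :=
  CategoryTheory.Quotient.lift _ S.Q h.map_eq

lemma Qbar_map (h : HasQuotientCalculus S) {A B : C} (f : A ⟶ B) :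
    h.Qbar.map ((quotFunctor S).map f) = S.Q.map f := rfl

lemma sBar_isInvertedBy (h : HasQuotientCalculus S) : (sBar S).IsInvertedBy h.Qbar := by
  intro A B g hg
  induction hg with
  | of_mem f hf => exact S.Q_inverts f hf
  | of_isIso f hf => infer_instance
  | comp f g _ _ hf hg => rw [Functor.map_comp]; infer_instance

lemma sBar_map_iff (h : HasQuotientCalculus S) {A B : C} (f : A ⟶ B) :
    sBar S ((quotFunctor S).map f) ↔ S f :=
  ⟨fun hf => (h.iff_isIso f).2 (h.sBar_isInvertedBy _ hf), fun hf => sBar.of_mem f hf⟩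

lemma sSat_iff (h : HasQuotientCalculus S) {A B : C} (f : A ⟶ B) : sSat S f ↔ S f :=
  h.sBar_map_iff f

/-- The localization of `C` by `S` is the localization of the ideal quotient by `S̄`. -/
noncomputable def strictUniversalProperty (h : HasQuotientCalculus S) (E : Type*) [Category* E] :
    Localization.StrictUniversalPropertyFixedTarget h.Qbar (sBar S) E where
  inverts := h.sBar_isInvertedBy
  lift G hG := Localization.Construction.lift (quotFunctor S ⋙ G) fun _ _ f hf =>
    hG _ (sBar.of_mem f hf)
  fac G hG := CategoryTheory.Quotient.lift_unique' _ _ _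
    (Localization.Construction.fac (quotFunctor S ⋙ G) fun _ _ f hf => hG _ (sBar.of_mem f hf))
  uniq _ _ hF := Localization.Construction.uniq _ _ (congrArg (quotFunctor S ⋙ ·) hF)

lemma isLocalization_Qbar (h : HasQuotientCalculus S) : h.Qbar.IsLocalization (sBar S) :=
  Functor.IsLocalization.mk' _ _ (h.strictUniversalProperty _) (h.strictUniversalProperty _)

lemma functor_map_eq_iff (h : HasQuotientCalculus S) {A B : C} (f g : A ⟶ B) :
    (quotFunctor S).map f = (quotFunctor S).map g ↔ idealRel S f g :=
  haveI := h.congruence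
  Quotient.functor_map_eq_iff _ f g

lemma map_eq' (h : HasQuotientCalculus S) {A B : C} (f g : A ⟶ B)
    (hfg : (quotFunctor S).map f = (quotFunctor S).map g) : S.Q.map f = S.Q.map g :=
  h.map_eq _ _ _ _ ((h.functor_map_eq_iff f g).1 hfg)

lemma id_mem (h : HasQuotientCalculus S) (A : C) : S (𝟙 A) := by
  rw [h.iff_isIso, S.Q.map_id]; infer_instance

lemma comp_mem (h : HasQuotientCalculus S) {A B K : C} (f : A ⟶ B) (g : B ⟶ K) (hf : S f)
    (hg : S g) : S (f ≫ g) := by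
  rw [h.iff_isIso] at *
  rw [S.Q.map_comp]; infer_instance

lemma mem_of_map_eq (h : HasQuotientCalculus S) {A B : C} (f g : A ⟶ B) (hf : S f)
    (hfg : S.Q.map f = S.Q.map g) : S g := by
  rw [h.iff_isIso] at *
  rwa [← hfg]

/-- Morphisms in the localization are left fractions. -/
lemma exists_left (h : HasQuotientCalculus S) {A B : C} (β : S.Q.obj A ⟶ S.Q.obj B) :
    ∃ (B' : C) (b : A ⟶ B') (s : B ⟶ B'), S s ∧ β ≫ S.Q.map s = S.Q.map b := by
  have := h.isLocalization_Qbar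
  have := h.mult.1
  obtain ⟨⟨b, s, hs⟩, hφ⟩ := Localization.exists_leftFraction h.Qbar (sBar S)
    (X := (quotFunctor S).obj A) (Y := (quotFunctor S).obj B) β
  rename_i B'
  obtain ⟨B'⟩ := B'
  obtain ⟨b, rfl⟩ := (quotFunctor S).map_surjective (X := A) (Y := B') b
  obtain ⟨s, rfl⟩ := (quotFunctor S).map_surjective (X := B) (Y := B') s
  refine ⟨B', b, s, (h.sBar_map_iff s).1 hs, ?_⟩
  rw [hφ, ← h.Qbar_map, ← h.Qbar_map]
  exact MorphismProperty.LeftFraction.map_comp_map_s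
    (⟨(quotFunctor S).map b, (quotFunctor S).map s, hs⟩ :
      (sBar S).LeftFraction ((quotFunctor S).obj A) ((quotFunctor S).obj B)) h.Qbar _

/-- Morphisms in the localization are right fractions. -/
lemma exists_right (h : HasQuotientCalculus S) {A B : C} (β : S.Q.obj A ⟶ S.Q.obj B) :
    ∃ (A' : C) (b : A' ⟶ B) (s : A' ⟶ A), S s ∧ S.Q.map s ≫ β = S.Q.map b := by
  have := h.isLocalization_Qbar
  have := h.mult.2
  obtain ⟨⟨s, hs, b⟩, hφ⟩ := Localization.exists_rightFraction h.Qbar (sBar S)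
    (X := (quotFunctor S).obj A) (Y := (quotFunctor S).obj B) β
  rename_i A'
  obtain ⟨A'⟩ := A'
  obtain ⟨b, rfl⟩ := (quotFunctor S).map_surjective (X := A') (Y := B) b
  obtain ⟨s, rfl⟩ := (quotFunctor S).map_surjective (X := A') (Y := A) s
  refine ⟨A', b, s, (h.sBar_map_iff s).1 hs, ?_⟩
  rw [hφ, ← h.Qbar_map, ← h.Qbar_map]
  exact MorphismProperty.RightFraction.map_s_comp_map
    (⟨(quotFunctor S).map s, hs, (quotFunctor S).map b⟩ :
      (sBar S).RightFraction ((quotFunctor S).obj A) ((quotFunctor S).obj B)) h.Qbar _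

lemma exists_postcomp (h : HasQuotientCalculus S) {A B : C} (f g : A ⟶ B)
    (hfg : S.Q.map f = S.Q.map g) :
    ∃ (B' : C) (s : B ⟶ B'), S s ∧ (quotFunctor S).map (f ≫ s) = (quotFunctor S).map (g ≫ s) := by
  have := h.isLocalization_Qbar
  have := h.mult.1
  obtain ⟨⟨B'⟩, s, hs, e⟩ := (MorphismProperty.map_eq_iff_postcomp h.Qbar (sBar S)
    ((quotFunctor S).map f) ((quotFunctor S).map g)).1 hfg
  obtain ⟨s, rfl⟩ := (quotFunctor S).map_surjective (X := B) (Y := B') s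
  exact ⟨B', s, (h.sBar_map_iff s).1 hs, by simpa [← Functor.map_comp] using e⟩

lemma exists_precomp (h : HasQuotientCalculus S) {A B : C} (f g : A ⟶ B)
    (hfg : S.Q.map f = S.Q.map g) :
    ∃ (A' : C) (s : A' ⟶ A), S s ∧ (quotFunctor S).map (s ≫ f) = (quotFunctor S).map (s ≫ g) := by
  have := h.isLocalization_Qbar
  have := h.mult.2
  obtain ⟨⟨A'⟩, s, hs, e⟩ := (MorphismProperty.map_eq_iff_precomp h.Qbar (sBar S)
    ((quotFunctor S).map f) ((quotFunctor S).map g)).1 hfg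
  obtain ⟨s, rfl⟩ := (quotFunctor S).map_surjective (X := A') (Y := A) s
  exact ⟨A', s, (h.sBar_map_iff s).1 hs, by simpa [← Functor.map_comp] using e⟩

/-- Two morphisms in the localization with the same source have a common denominator. -/
lemma exists_left₂ (h : HasQuotientCalculus S) {A A' B : C} (α : S.Q.obj A ⟶ S.Q.obj B)
    (β : S.Q.obj A' ⟶ S.Q.obj B) :
    ∃ (B' : C) (a : A ⟶ B') (b : A' ⟶ B') (s : B ⟶ B'), S s ∧
      α ≫ S.Q.map s = S.Q.map a ∧ β ≫ S.Q.map s = S.Q.map b := by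
  obtain ⟨B₁, a, s, hs, ha⟩ := h.exists_left α
  obtain ⟨B₂, b, t, ht, hb⟩ := h.exists_left (β ≫ S.Q.map s)
  exact ⟨B₂, a ≫ t, b, s ≫ t, h.comp_mem s t hs ht, by simp [reassoc_of% ha], by simpa using hb⟩

lemma exists_right₂ (h : HasQuotientCalculus S) {A B B' : C} (α : S.Q.obj A ⟶ S.Q.obj B)
    (β : S.Q.obj A ⟶ S.Q.obj B') :
    ∃ (A' : C) (a : A' ⟶ B) (b : A' ⟶ B') (s : A' ⟶ A), S s ∧
      S.Q.map s ≫ α = S.Q.map a ∧ S.Q.map s ≫ β = S.Q.map b := by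
  obtain ⟨A₁, a, s, hs, ha⟩ := h.exists_right α
  obtain ⟨A₂, b, t, ht, hb⟩ := h.exists_right (S.Q.map s ≫ β)
  exact ⟨A₂, t ≫ a, b, t ≫ s, h.comp_mem t s ht hs, by simp [ha], by simpa using hb⟩

end Calculus

end HasQuotientCalculus

open ExtStructure

/-! ### Extensions which vanish in the localization -/

/-- The middle component of a morphism of triangles belongs to `S` if the outer ones do. -/
def IsCompatibleWithTriangles {C : Type u} [Category.{v} C] {pC : Preadditive C}
    (X : ExtStructure.{w} C) (S : MorphismProperty C) : Prop :=
  ∀ {A B K A' B' K' : C} {x : A ⟶ B} {y : B ⟶ K} {δ : X.Ext K A} {x' : A' ⟶ B'}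
    {y' : B' ⟶ K'} {δ' : X.Ext K' A'}, X.IsTriangle x y δ → X.IsTriangle x' y' δ' →
    ∀ (a : A ⟶ A') (b : B ⟶ B') (c : K ⟶ K'), push a δ = pull c δ' → x ≫ b = a ≫ x' →
      b ≫ y' = y ≫ c → S a → S c → S b

section Killed

open scoped ZeroObject

variable {C : Type u} [Category.{v} C] {pC : Preadditive C} [HasZeroObject C]
  [HasBinaryBiproducts C] {X : ExtStructure.{w} C} (hX : X.IsWeaklyExtriangulated)
  {S : MorphismProperty C} (h : HasQuotientCalculus S) (hT : IsCompatibleWithTriangles X S)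
include h

lemma killed_iff {K A : C} (δ : X.Ext K A) :
    killed X S δ ↔ ∃ (A' : C) (s : A ⟶ A'), S s ∧ push s δ = 0 := by
  simp only [killed, h.sSat_iff]

lemma killed_of_push_eq_zero {K A A' : C} {δ : X.Ext K A} (s : A ⟶ A') (hs : S s)
    (hδ : push s δ = 0) : killed X S δ :=
  (killed_iff h δ).2 ⟨A', s, hs, hδ⟩

lemma killed_of_killed_push {K A A' : C} {δ : X.Ext K A} (s : A ⟶ A') (hs : S s)
    (hδ : killed X S (push s δ)) : killed X S δ := by
  obtain ⟨A'', s', hs', hδ⟩ := (killed_iff h _).1 hδ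
  exact killed_of_push_eq_zero h (s ≫ s') (h.comp_mem _ _ hs hs') (by rw [push_comp, hδ])

lemma killed_zero {K A : C} : killed X S (0 : X.Ext K A) :=
  killed_of_push_eq_zero h (𝟙 A) (h.id_mem A) (push_zero _)

lemma killed_pull {K K' A : C} {δ : X.Ext K A} (c : K' ⟶ K) (hδ : killed X S δ) :
    killed X S (pull c δ) := by
  obtain ⟨A', s, hs, hδ⟩ := (killed_iff h _).1 hδ
  exact killed_of_push_eq_zero h s hs (by rw [← pull_push, hδ, pull_zero])

include hX hT

lemma exists_pull_eq_zero {K A : C} {δ : X.Ext K A} (hδ : killed X S δ) :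
    ∃ (K' : C) (t : K' ⟶ K), S t ∧ pull t δ = 0 := by
  obtain ⟨A', s, hs, hδ⟩ := (killed_iff h _).1 hδ
  obtain ⟨B, x, y, hxy⟩ := exists_isTriangle δ
  obtain ⟨B', x', y', hxy'⟩ := exists_isTriangle (push s δ)
  obtain ⟨b, hb, hb'⟩ := hX.exists_hom hxy hxy' s (𝟙 K) (by simp)
  have hbS := hT hxy hxy' s b (𝟙 K) (by simp) hb hb' hs (h.id_mem K)
  have := (h.iff_isIso b).1 hbS
  obtain ⟨k, hk⟩ := hX.exists_lift_y hxy' (𝟙 K) (by rw [hδ, pull_zero])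
  obtain ⟨K', e, t, ht, he⟩ := h.exists_right (S.Q.map k ≫ inv (S.Q.map b))
  refine ⟨K', e ≫ y, h.mem_of_map_eq t _ ht ?_, ?_⟩
  · have : inv (S.Q.map b) ≫ S.Q.map y = S.Q.map y' := by
      rw [IsIso.inv_comp_eq, ← S.Q.map_comp, hb', Category.comp_id]
    rw [S.Q.map_comp, ← he, Category.assoc, Category.assoc, this, ← S.Q.map_comp, hk, S.Q.map_id,
      Category.comp_id]
  · rw [pull_comp, hX.pull_eq_zero hxy, pull_zero]

lemma killed_of_pull_eq_zero {K K' A : C} {δ : X.Ext K A} (t : K' ⟶ K) (ht : S t)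
    (hδ : pull t δ = 0) : killed X S δ := by
  obtain ⟨B, x, y, hxy⟩ := exists_isTriangle δ
  obtain ⟨B', x', y', hxy'⟩ := exists_isTriangle (pull t δ)
  obtain ⟨b, hb, hb'⟩ := hX.exists_hom hxy' hxy (𝟙 A) t (by simp)
  have hbS := hT hxy' hxy (𝟙 A) b t (by simp) hb hb' (h.id_mem A) ht
  have := (h.iff_isIso b).1 hbS
  obtain ⟨r, hr⟩ := hX.exists_desc_x hxy' (𝟙 A) (by rw [hδ, push_zero])
  obtain ⟨A', e, s, hs, he⟩ := h.exists_left (inv (S.Q.map b) ≫ S.Q.map r)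
  refine killed_of_push_eq_zero h (x ≫ e) (h.mem_of_map_eq s _ hs ?_) ?_
  · have : S.Q.map x ≫ inv (S.Q.map b) = S.Q.map x' := by
      rw [IsIso.comp_inv_eq, ← S.Q.map_comp, hb, Category.id_comp]
    rw [S.Q.map_comp, ← he, ← Category.assoc, ← Category.assoc, this, ← S.Q.map_comp, hr,
      S.Q.map_id, Category.id_comp]
  · rw [push_comp, hX.push_eq_zero hxy, push_zero]

lemma killed_of_killed_pull {K K' A : C} {δ : X.Ext K A} (t : K' ⟶ K) (ht : S t)
    (hδ : killed X S (pull t δ)) : killed X S δ := by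
  obtain ⟨K'', t', ht', hδ⟩ := exists_pull_eq_zero hX h hT hδ
  exact killed_of_pull_eq_zero hX h hT (t' ≫ t) (h.comp_mem _ _ ht' ht) (by rw [pull_comp, hδ])

lemma killed_push {K A A' : C} {δ : X.Ext K A} (a : A ⟶ A') (hδ : killed X S δ) :
    killed X S (push a δ) := by
  obtain ⟨K', t, ht, hδ⟩ := exists_pull_eq_zero hX h hT hδ
  exact killed_of_pull_eq_zero hX h hT t ht (by rw [pull_push, hδ, push_zero])

lemma killed_push_sub_of_quot {K A A' : C} (δ : X.Ext K A) (f g : A ⟶ A')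
    (hfg : (quotFunctor S).map f = (quotFunctor S).map g) :
    killed X S (push f δ - push g δ) := by
  obtain ⟨N, hN, i, j, e⟩ := (h.functor_map_eq_iff g f).1 hfg.symm
  rw [e, add_push, add_sub_cancel_left, push_comp]
  exact killed_push hX h hT _
    (killed_of_push_eq_zero h _ (hN 0 (isZero_zero C)).1 (zero_push _))

lemma killed_pull_sub_of_quot {K K' A : C} (δ : X.Ext K A) (f g : K' ⟶ K)
    (hfg : (quotFunctor S).map f = (quotFunctor S).map g) :
    killed X S (pull f δ - pull g δ) := by
  obtain ⟨N, hN, i, j, e⟩ := (h.functor_map_eq_iff g f).1 hfg.symm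
  rw [e, add_pull, add_sub_cancel_left, pull_comp]
  exact killed_pull h _
    (killed_of_pull_eq_zero hX h hT _ (hN 0 (isZero_zero C)).2 (zero_pull _))

lemma killed_add {K A : C} {δ₁ δ₂ : X.Ext K A} (h₁ : killed X S δ₁) (h₂ : killed X S δ₂) :
    killed X S (δ₁ + δ₂) := by
  obtain ⟨A₁, s₁, hs₁, h₁⟩ := (killed_iff h _).1 h₁
  obtain ⟨A₂, s₂, hs₂, h₂⟩ := (killed_iff h _).1 h₂
  have := (h.iff_isIso _).1 hs₁
  obtain ⟨A', b, w, hw, e⟩ := h.exists_left (inv (S.Q.map s₁) ≫ S.Q.map s₂)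
  obtain ⟨A'', w', hw', e'⟩ := h.exists_postcomp (s₂ ≫ w) (s₁ ≫ b) (by
    rw [S.Q.map_comp, S.Q.map_comp, ← e]; simp)
  refine killed_of_killed_push h ((s₂ ≫ w) ≫ w') (h.comp_mem _ _ (h.comp_mem _ _ hs₂ hw) hw') ?_
  have := killed_push_sub_of_quot hX h hT δ₁ _ _ e'
  rw [Category.assoc, Category.assoc, push_comp s₁, h₁, push_zero, sub_zero] at this
  rwa [push_add, Category.assoc, push_comp s₂ _ δ₂, h₂, push_zero, add_zero]

/-- The subgroup `𝒦(K, A) ⊆ 𝔼(K, A)`. -/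
def killedSubgroup (K A : C) : AddSubgroup (X.Ext K A) where
  carrier := { δ | killed X S δ }
  zero_mem' := killed_zero h
  add_mem' := killed_add hX h hT
  neg_mem' {δ} hδ := by
    obtain ⟨A', s, hs, hδ⟩ := (killed_iff h _).1 hδ
    refine killed_of_push_eq_zero h s hs ?_
    rw [← zero_sub, push_sub, hδ, push_zero, sub_zero]

end Killed

/-! ### Left Kan extensions along localizations -/

section Kan

variable {B : Type u} [Category.{v} B] {B' : Type u'} [Category.{v'} B'] (L : B ⥤ B')
  (W : MorphismProperty B) [L.IsLocalization W] [W.HasLeftCalculusOfFractions]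
include W

lemma exists_leftFraction_of_isLocalization {b₁ b₂ : B} (β : L.obj b₁ ⟶ L.obj b₂) :
    ∃ (b : B) (f : b₁ ⟶ b) (s : b₂ ⟶ b), W s ∧ β ≫ L.map s = L.map f := by
  obtain ⟨φ, rfl⟩ := Localization.exists_leftFraction L W β
  exact ⟨_, φ.f, φ.s, φ.hs, φ.map_comp_map_s L _⟩

lemma isFiltered_costructuredArrow (Y : B') : IsFiltered (CostructuredArrow L Y) := by
  have hL := Localization.essSurj L W
  let b₀ := L.objPreimage Y
  let e : L.obj b₀ ≅ Y := L.objObjPreimageIso Y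
  have hW : ∀ {a b : B} (s : a ⟶ b), W s → IsIso (L.map s) := fun s hs =>
    Localization.inverts L W s hs
  refine { cocone_objs := ?_, cocone_maps := ?_, nonempty := ⟨CostructuredArrow.mk e.hom⟩ }
  · intro i j
    obtain ⟨c, f, s, hs, hf⟩ := exists_leftFraction_of_isLocalization L W (i.hom ≫ e.inv)
    obtain ⟨c', g, t, ht, hg⟩ :=
      exists_leftFraction_of_isLocalization L W (j.hom ≫ e.inv ≫ L.map s)
    have := hW s hs
    have := hW t ht
    refine ⟨CostructuredArrow.mk (inv (L.map t) ≫ inv (L.map s) ≫ e.hom),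
      CostructuredArrow.homMk (f ≫ t) ?_, CostructuredArrow.homMk g ?_, trivial⟩
    · simp [← hf]
    · simp [← hg]
  · intro i j f g
    obtain ⟨c, b, s, hs, hb⟩ := exists_leftFraction_of_isLocalization L W (j.hom ≫ e.inv)
    have hfg : L.map (f.left ≫ b) = L.map (g.left ≫ b) := by
      rw [L.map_comp, L.map_comp, ← hb, Category.assoc, CostructuredArrow.w_assoc,
        CostructuredArrow.w_assoc]
    obtain ⟨c', t, ht, e'⟩ := (MorphismProperty.map_eq_iff_postcomp L W _ _).1 hfg
    have := hW s hs
    have := hW t ht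
    refine ⟨CostructuredArrow.mk (inv (L.map t) ≫ inv (L.map s) ≫ e.hom),
      CostructuredArrow.homMk (b ≫ t) ?_, ?_⟩
    · simp [← reassoc_of% hb]
    · ext
      simpa using e'

variable (M : B ⥤ AddCommGrpCat.{w}) [L.HasPointwiseLeftKanExtension M]
  [∀ Y, PreservesColimit (CostructuredArrow.proj L Y ⋙ M) (forget AddCommGrpCat.{w})]

omit [L.IsLocalization W] [W.HasLeftCalculusOfFractions] W in
lemma exists_rep_pointwiseLeftKanExtension (Y : B')
    (e : (L.pointwiseLeftKanExtension M).obj Y) :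
    ∃ (b : B) (β : L.obj b ⟶ Y) (m : M.obj b),
      e = ((L.pointwiseLeftKanExtension M).map β).hom
        (((L.pointwiseLeftKanExtensionUnit M).app b).hom m) := by
  obtain ⟨j, m, rfl⟩ := Concrete.colimit_exists_rep (CostructuredArrow.proj L Y ⋙ M) e
  refine ⟨j.left, j.hom, m, ?_⟩
  have h : (L.pointwiseLeftKanExtensionUnit M).app j.left ≫
      (L.pointwiseLeftKanExtension M).map j.hom =
        colimit.ι (CostructuredArrow.proj L Y ⋙ M) j := by
    rw [Functor.pointwiseLeftKanExtensionUnit_app, Functor.pointwiseLeftKanExtension_map]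
    refine (colimit.ι_desc _ _).trans ?_
    have hw := colimit.w (CostructuredArrow.proj L Y ⋙ M) (CostructuredArrow.homMk (𝟙 j.left)
      (by simp) : (CostructuredArrow.map j.hom).obj (CostructuredArrow.mk (𝟙 (L.obj j.left))) ⟶ j)
    refine hw.symm.trans ?_
    refine (congrArg (· ≫ _) (M.map_id j.left)).trans (Category.id_comp _)
  exact (ConcreteCategory.congr_hom h m).symm

lemma exists_map_eq_zero_of_unit_eq_zero (b : B) (m : M.obj b)
    (hm : ((L.pointwiseLeftKanExtensionUnit M).app b).hom m = 0) :
    ∃ (b' : B) (s : b ⟶ b'), W s ∧ (M.map s).hom m = 0 := by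
  have := isFiltered_costructuredArrow L W (L.obj b)
  have h0 : colimit.ι (CostructuredArrow.proj L (L.obj b) ⋙ M) (CostructuredArrow.mk (𝟙 _)) m =
      colimit.ι (CostructuredArrow.proj L (L.obj b) ⋙ M) (CostructuredArrow.mk (𝟙 _)) 0 := by
    rw [map_zero]
    exact hm
  obtain ⟨k, f, g, e⟩ := (Concrete.colimit_rep_eq_iff_exists
    (CostructuredArrow.proj L (L.obj b) ⋙ M) _ _).1 h0
  rw [map_zero] at e
  obtain ⟨c, d, s, hs, hd⟩ := exists_leftFraction_of_isLocalization L W k.hom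
  have hw : L.map (f.left ≫ d) = L.map s := by
    rw [L.map_comp, ← hd, CostructuredArrow.w_assoc]
    simp
  obtain ⟨c', t, ht, e'⟩ := (MorphismProperty.map_eq_iff_postcomp L W _ _).1 hw
  refine ⟨c', s ≫ t, W.comp_mem _ _ hs ht, ?_⟩
  rw [← e', M.map_comp, M.map_comp]
  have e : (M.map f.left).hom m = 0 := e
  simp [e]

end Kan

/-! ### Products of calculi of fractions -/

section Prod

variable {B : Type u} [Category.{v} B] {B' : Type u'} [Category.{v'} B']
  (W : MorphismProperty B) (W' : MorphismProperty B')

lemma hasLeftCalculusOfFractions_prod [W.HasLeftCalculusOfFractions]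
    [W'.HasLeftCalculusOfFractions] : (W.prod W').HasLeftCalculusOfFractions where
  id_mem := fun b => ⟨W.id_mem b.1, W'.id_mem b.2⟩
  comp_mem := fun f g hf hg => ⟨W.comp_mem _ _ hf.1 hg.1, W'.comp_mem _ _ hf.2 hg.2⟩
  exists_leftFraction := by
    rintro ⟨a, a'⟩ ⟨b, b'⟩ ⟨⟨s, s'⟩, hs, ⟨f, f'⟩⟩
    obtain ⟨⟨g, t, ht⟩, e⟩ := (⟨s, hs.1, f⟩ : W.RightFraction a b).exists_leftFraction
    obtain ⟨⟨g', t', ht'⟩, e'⟩ := (⟨s', hs.2, f'⟩ : W'.RightFraction a' b').exists_leftFraction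
    exact ⟨{ Y' := ⟨_, _⟩, f := ⟨g, g'⟩, s := ⟨t, t'⟩, hs := ⟨ht, ht'⟩ }, Prod.ext e e'⟩
  ext := by
    rintro ⟨a, a'⟩ ⟨b, b'⟩ ⟨c, c'⟩ f g s hs e
    obtain ⟨d, t, ht, h⟩ := MorphismProperty.HasLeftCalculusOfFractions.ext f.1 g.1 s.1 hs.1
      (congrArg Prod.fst e)
    obtain ⟨d', t', ht', h'⟩ := MorphismProperty.HasLeftCalculusOfFractions.ext f.2 g.2 s.2 hs.2
      (congrArg Prod.snd e)
    exact ⟨⟨d, d'⟩, ⟨t, t'⟩, ⟨ht, ht'⟩, Prod.ext h h'⟩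

lemma map_eq_comp_of_prod {E : Type*} [Category* E] (G : B × B' ⥤ E) {a a' : B} {b b' : B'}
    (f : (a, b) ⟶ (a', b')) :
    G.map f = G.map (Prod.mkHom (𝟙 a) f.2 : (a, b) ⟶ (a, b')) ≫
      G.map (Prod.mkHom f.1 (𝟙 b') : (a, b') ⟶ (a', b')) := by
  rw [← G.map_comp]
  congr 1
  ext <;> simp

end Prod

/-! ### The localized bifunctor -/

/-- A bifunctor on the localization together with a natural transformation from `𝔼`
whose kernel consists of the killed extensions and whose image generates. -/
structure LocalizedExt {C : Type u} [Category.{v} C] {pC : Preadditive C}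
    (X : ExtStructure.{w} C) (S : MorphismProperty C) where
  E : S.Localizationᵒᵖ ⥤ S.Localization ⥤ AddCommGrpCat.{max u v w}
  μ : ∀ K A : C, X.Ext K A →+ (E.obj (op (S.Q.obj K))).obj (S.Q.obj A)
  μ_push : ∀ {K A A' : C} (a : A ⟶ A') (δ : X.Ext K A),
    μ K A' (push a δ) = ((E.obj (op (S.Q.obj K))).map (S.Q.map a)).hom (μ K A δ)
  μ_pull : ∀ {K K' A : C} (c : K' ⟶ K) (δ : X.Ext K A),
    μ K' A (pull c δ) = ((E.map (S.Q.map c).op).app (S.Q.obj A)).hom (μ K A δ)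
  exists_rep : ∀ {K A : S.Localization} (e : (E.obj (op K)).obj A),
    ∃ (Z Y : C) (γ : K ⟶ S.Q.obj Z) (α : S.Q.obj Y ⟶ A) (δ : X.Ext Z Y),
      e = ((E.map γ.op).app A).hom (((E.obj (op (S.Q.obj Z))).map α).hom (μ Z Y δ))
  killed_of_eq_zero : ∀ {K A : C} (δ : X.Ext K A), μ K A δ = 0 → killed X S δ

section LocalizedExt

variable {C : Type u} [Category.{v} C] {pC : Preadditive C} [HasZeroObject C]
  [HasBinaryBiproducts C] {X : ExtStructure.{w} C} (hX : X.IsWeaklyExtriangulated)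
  {S : MorphismProperty C} (h : HasQuotientCalculus S) (hT : IsCompatibleWithTriangles X S)

/-- The map `c^* a_*` on `𝔼/𝒦`. -/
def quotMap {K K' A A' : C} (c : K' ⟶ K) (a : A ⟶ A') :
    X.Ext K A ⧸ killedSubgroup hX h hT K A →+ X.Ext K' A' ⧸ killedSubgroup hX h hT K' A' :=
  QuotientAddGroup.map _ _ (((X.E.map c.op).app A').hom.comp ((X.E.obj (op K)).map a).hom)
    fun _ hδ => killed_pull h c (killed_push hX h hT a hδ)

lemma quotMap_eq {K K' A A' : C} {c c' : K' ⟶ K} {a a' : A ⟶ A'}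
    (hc : (quotFunctor S).map c = (quotFunctor S).map c')
    (ha : (quotFunctor S).map a = (quotFunctor S).map a') :
    quotMap hX h hT c a = quotMap hX h hT c' a' := by
  ext δ
  refine (QuotientAddGroup.eq_iff_sub_mem).2 ?_
  change killed X S (pull c (push a δ) - pull c' (push a' δ))
  have h₁ := killed_pull h c (killed_push_sub_of_quot hX h hT δ a a' ha)
  have h₂ := killed_pull_sub_of_quot hX h hT (push a' δ) c c' hc
  have := killed_add hX h hT h₁ h₂
  rwa [pull_sub, sub_add_sub_cancel] at this

/-- The bifunctor `𝔼/𝒦` on the ideal quotient. -/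
noncomputable def quotExt : (IdealQuot S)ᵒᵖ × IdealQuot S ⥤ AddCommGrpCat.{w} where
  obj p := AddCommGrpCat.of (X.Ext p.1.unop.as p.2.as ⧸ killedSubgroup hX h hT _ _)
  map {p q} f := AddCommGrpCat.ofHom (quotMap hX h hT
    ((quotFunctor S).preimage (X := q.1.unop.as) (Y := p.1.unop.as) f.1.unop)
    ((quotFunctor S).preimage (X := p.2.as) (Y := q.2.as) f.2))
  map_id p := by
    rw [quotMap_eq hX h hT (c' := 𝟙 _) (a' := 𝟙 _) (by simp; rfl) (by simp; rfl)]
    ext δ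
    refine congrArg (QuotientAddGroup.mk (s := killedSubgroup hX h hT _ _)) ?_
    exact (pull_id _).trans (push_id δ)
  map_comp {p q r} f g := by
    rw [quotMap_eq hX h hT
      (c' := (quotFunctor S).preimage (X := r.1.unop.as) (Y := q.1.unop.as) g.1.unop ≫
        (quotFunctor S).preimage (X := q.1.unop.as) (Y := p.1.unop.as) f.1.unop)
      (a' := (quotFunctor S).preimage (X := p.2.as) (Y := q.2.as) f.2 ≫
        (quotFunctor S).preimage (X := q.2.as) (Y := r.2.as) g.2) (by simp) (by simp)]
    ext δ
    refine congrArg (QuotientAddGroup.mk (s := killedSubgroup hX h hT _ _)) ?_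
    change pull _ (push _ (δ : X.Ext _ _)) = pull _ (push _ (pull _ (push _ δ)))
    rw [pull_comp, push_comp, ← pull_push]

lemma quotExt_map_mk {K K' A A' : C} (c : K' ⟶ K) (a : A ⟶ A') (δ : X.Ext K A) :
    ((quotExt hX h hT).map (Prod.mkHom ((quotFunctor S).map c).op ((quotFunctor S).map a) :
      (op ((quotFunctor S).obj K), (quotFunctor S).obj A) ⟶
        (op ((quotFunctor S).obj K'), (quotFunctor S).obj A'))).hom
      (QuotientAddGroup.mk δ) = QuotientAddGroup.mk (pull c (push a δ)) := by
  change quotMap hX h hT _ _ (QuotientAddGroup.mk δ) = _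
  rw [quotMap_eq hX h hT (c' := c) (a' := a) (by simp) (by simp)]
  rfl

include hX h hT in
lemma exists_localizedExt : Nonempty (LocalizedExt X S) := by
  have := h.isLocalization_Qbar
  have := h.mult.1
  have := h.mult.2
  let W := (sBar S).op.prod (sBar S)
  let P : (IdealQuot S)ᵒᵖ × IdealQuot S ⥤ S.Localizationᵒᵖ × S.Localization :=
    h.Qbar.op.prod h.Qbar
  have hW : W.HasLeftCalculusOfFractions := hasLeftCalculusOfFractions_prod _ _
  have hP : P.IsLocalization W := inferInstance
  let M : (IdealQuot S)ᵒᵖ × IdealQuot S ⥤ AddCommGrpCat.{max u v w} :=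
    quotExt hX h hT ⋙ AddCommGrpCat.uliftFunctor.{max u v, w}
  have hM : P.HasPointwiseLeftKanExtension M := fun Y => inferInstance
  have hM' : ∀ Y, PreservesColimit (CostructuredArrow.proj P Y ⋙ M)
      (forget AddCommGrpCat.{max u v w}) := fun Y => by
    have := isFiltered_costructuredArrow P W Y
    have : PreservesFilteredColimitsOfSize.{v, max u v} (forget AddCommGrpCat.{max u v w}) :=
      preservesFilteredColimitsOfSize_shrink.{max u v, max u v w, v, max u v w} _
    infer_instance
  let E := P.pointwiseLeftKanExtension M
  let η := P.pointwiseLeftKanExtensionUnit M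
  have hη : ∀ {K K' A A' : C} (c : K' ⟶ K) (a : A ⟶ A') (δ : X.Ext K A),
      (η.app (op ((quotFunctor S).obj K'), (quotFunctor S).obj A')).hom
        ⟨QuotientAddGroup.mk (pull c (push a δ))⟩ =
      (E.map (Prod.mkHom (S.Q.map c).op (S.Q.map a))).hom
        ((η.app (op ((quotFunctor S).obj K), (quotFunctor S).obj A)).hom
          ⟨QuotientAddGroup.mk δ⟩) := by
    intro K K' A A' c a δ
    have := ConcreteCategory.congr_hom (η.naturality (Prod.mkHom ((quotFunctor S).map c).op
      ((quotFunctor S).map a) : (op ((quotFunctor S).obj K), (quotFunctor S).obj A) ⟶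
        (op ((quotFunctor S).obj K'), (quotFunctor S).obj A'))) ⟨QuotientAddGroup.mk δ⟩
    rw [← quotExt_map_mk]
    exact this
  refine ⟨{
    E := Functor.curry.obj E
    μ := fun K A => (η.app (op ((quotFunctor S).obj K), (quotFunctor S).obj A)).hom.comp
      ((AddEquiv.ulift.symm.toAddMonoidHom).comp
        (QuotientAddGroup.mk' (killedSubgroup hX h hT K A)))
    μ_push := ?_
    μ_pull := ?_
    exists_rep := ?_
    killed_of_eq_zero := ?_ }⟩
  · intro K A A' a δ
    have := hη (𝟙 K) a δ
    rw [pull_id, S.Q.map_id] at this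
    exact this
  · intro K K' A c δ
    have := hη c (𝟙 A) δ
    rw [push_id, S.Q.map_id] at this
    exact this
  · intro K A e
    obtain ⟨⟨⟨⟨Z⟩⟩, ⟨Y⟩⟩, β, ⟨m⟩, rfl⟩ := exists_rep_pointwiseLeftKanExtension P M (op K, A) e
    obtain ⟨δ, rfl⟩ := QuotientAddGroup.mk_surjective m
    refine ⟨Z, Y, β.1.unop, β.2, δ, ?_⟩
    exact ConcreteCategory.congr_hom (map_eq_comp_of_prod E (a := op (S.Q.obj Z)) (b := S.Q.obj Y) β)
      ((η.app (op ((quotFunctor S).obj Z), (quotFunctor S).obj Y)).hom ⟨QuotientAddGroup.mk δ⟩)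
  · intro K A δ hδ
    obtain ⟨⟨⟨⟨Z⟩⟩, ⟨Y⟩⟩, s, hs, e⟩ := exists_map_eq_zero_of_unit_eq_zero P W M
      (op ((quotFunctor S).obj K), (quotFunctor S).obj A) ⟨QuotientAddGroup.mk δ⟩ hδ
    obtain ⟨t, ht⟩ := (quotFunctor S).map_surjective (X := Z) (Y := K) s.1.unop
    obtain ⟨s', hs'⟩ := (quotFunctor S).map_surjective (X := A) (Y := Y) s.2
    have key : s = Prod.mkHom ((quotFunctor S).map t).op ((quotFunctor S).map s') := by
      rw [ht, hs']; rfl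
    subst key
    have e' : ((quotExt hX h hT).map (Prod.mkHom ((quotFunctor S).map t).op
      ((quotFunctor S).map s') : (op ((quotFunctor S).obj K), (quotFunctor S).obj A) ⟶
        (op ((quotFunctor S).obj Z), (quotFunctor S).obj Y))).hom
      (QuotientAddGroup.mk δ) = 0 := congrArg ULift.down e
    rw [quotExt_map_mk] at e'
    have e'' : killed X S (pull t (push s' δ)) := (QuotientAddGroup.eq_zero_iff _).1 e'
    exact killed_of_killed_push h s' ((h.sBar_map_iff _).1 hs.2)
      (killed_of_killed_pull hX h hT t ((h.sBar_map_iff _).1 hs.1) e'')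

end LocalizedExt

/-! ### The additive structure of the localization -/

section Additive

variable {C : Type u} [Category.{v} C] {pC : Preadditive C} {S : MorphismProperty C}

lemma HasQuotientCalculus.exists_preadditive (h : HasQuotientCalculus S) :
    ∃ _ : Preadditive S.Localization, S.Q.Additive := by
  have := h.congruence
  have := h.isLocalization_Qbar
  have := h.mult.1
  let _ : Preadditive (IdealQuot S) := Quotient.preadditive _ h.add
  have h₁ : (quotFunctor S).Additive := Quotient.functor_additive _ h.add
  let _ : Preadditive S.Localization := Localization.preadditive h.Qbar (sBar S)
  have h₂ : h.Qbar.Additive := Localization.functor_additive h.Qbar (sBar S)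
  exact ⟨inferInstance, inferInstanceAs (quotFunctor S ⋙ h.Qbar).Additive⟩

lemma exists_obj_eq (A : S.Localization) : ∃ A₀ : C, S.Q.obj A₀ = A :=
  (Localization.Construction.objEquiv S).surjective A

lemma hasZeroObject_localization [HasZeroObject C] [Preadditive S.Localization] [S.Q.Additive] :
    HasZeroObject S.Localization :=
  S.Q.hasZeroObject_of_additive

lemma hasBinaryBiproducts_localization [HasBinaryBiproducts C] [Preadditive S.Localization]
    [S.Q.Additive] : HasBinaryBiproducts S.Localization where
  has_binary_biproduct A B := by
    obtain ⟨A, rfl⟩ := exists_obj_eq A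
    obtain ⟨B, rfl⟩ := exists_obj_eq B
    have := preservesBinaryBiproducts_of_preservesBiproducts S.Q
    exact S.Q.hasBinaryBiproduct_of_preserves A B

end Additive

namespace LocalizedExt

section Raw

variable {C : Type u} [Category.{v} C] {pC : Preadditive C} {X : ExtStructure.{w} C}
  {S : MorphismProperty C} (h : HasQuotientCalculus S) (Λ : LocalizedExt X S)

lemma additive_right [Preadditive S.Localization] [S.Q.Additive] (h : HasQuotientCalculus S)
    (K : S.Localizationᵒᵖ) : (Λ.E.obj K).Additive := by
  obtain ⟨K⟩ := K
  refine ⟨fun {A A' f g} => ?_⟩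
  ext e
  obtain ⟨Z, Y, γ, α, δ, rfl⟩ := Λ.exists_rep e
  have nat : ∀ φ : A ⟶ A', ((Λ.E.obj (op K)).map φ).hom (((Λ.E.map γ.op).app A).hom
      (((Λ.E.obj (op (S.Q.obj Z))).map α).hom (Λ.μ Z Y δ))) = ((Λ.E.map γ.op).app A').hom
      (((Λ.E.obj (op (S.Q.obj Z))).map (α ≫ φ)).hom (Λ.μ Z Y δ)) := by
    intro φ
    rw [Functor.map_comp]
    exact (ConcreteCategory.congr_hom ((Λ.E.map γ.op).naturality φ) _).symm
  obtain ⟨A', rfl⟩ := exists_obj_eq A'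
  obtain ⟨A₁, a, b, s, hs, ha, hb⟩ := h.exists_left₂ (α ≫ f) (α ≫ g)
  have := (h.iff_isIso s).1 hs
  have key : ((Λ.E.obj (op (S.Q.obj Z))).map (α ≫ (f + g))).hom (Λ.μ Z Y δ) =
      ((Λ.E.obj (op (S.Q.obj Z))).map (α ≫ f)).hom (Λ.μ Z Y δ) +
        ((Λ.E.obj (op (S.Q.obj Z))).map (α ≫ g)).hom (Λ.μ Z Y δ) := by
    have hinj : Function.Injective ((Λ.E.obj (op (S.Q.obj Z))).map (S.Q.map s)).hom :=
      (ConcreteCategory.bijective_of_isIso ((Λ.E.obj (op (S.Q.obj Z))).map (S.Q.map s))).1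
    apply hinj
    rw [map_add]
    have hc : ∀ (φ : S.Q.obj Y ⟶ S.Q.obj A') (c : Y ⟶ A₁), φ ≫ S.Q.map s = S.Q.map c →
        ((Λ.E.obj (op (S.Q.obj Z))).map (S.Q.map s)).hom
          (((Λ.E.obj (op (S.Q.obj Z))).map φ).hom (Λ.μ Z Y δ)) = Λ.μ Z A₁ (push c δ) := by
      intro φ c hφ
      rw [Λ.μ_push, ← hφ, Functor.map_comp]
      rfl
    rw [hc _ _ ha, hc _ _ hb, hc _ (a + b) (by
      rw [Preadditive.comp_add, Preadditive.add_comp, ha, hb, S.Q.map_add]), add_push, map_add]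
  change _ = ((Λ.E.obj (op K)).map f).hom _ + ((Λ.E.obj (op K)).map g).hom _
  rw [nat, nat, nat, key, map_add]

lemma additive_left [Preadditive S.Localization] [S.Q.Additive] (h : HasQuotientCalculus S) :
    Λ.E.Additive := by
  refine ⟨fun {K K' f g} => ?_⟩
  obtain ⟨K⟩ := K
  obtain ⟨K'⟩ := K'
  obtain ⟨f, rfl⟩ : ∃ f' : K' ⟶ K, f = f'.op := ⟨f.unop, rfl⟩
  obtain ⟨g, rfl⟩ : ∃ g' : K' ⟶ K, g = g'.op := ⟨g.unop, rfl⟩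
  ext A e
  obtain ⟨Z, Y, γ, α, δ, rfl⟩ := Λ.exists_rep e
  have nat : ∀ φ : K' ⟶ K, ((Λ.E.map φ.op).app A).hom (((Λ.E.map γ.op).app A).hom
      (((Λ.E.obj (op (S.Q.obj Z))).map α).hom (Λ.μ Z Y δ))) = ((Λ.E.obj (op K')).map α).hom
      (((Λ.E.map (φ ≫ γ).op).app (S.Q.obj Y)).hom (Λ.μ Z Y δ)) := by
    intro φ
    refine Eq.trans ?_ (ConcreteCategory.congr_hom ((Λ.E.map (φ ≫ γ).op).naturality α) _)
    rw [op_comp, Functor.map_comp, NatTrans.comp_app]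
    rfl
  obtain ⟨K', rfl⟩ := exists_obj_eq K'
  obtain ⟨K₁, a, b, t, ht, ha, hb⟩ := h.exists_right₂ (f ≫ γ) (g ≫ γ)
  have := (h.iff_isIso t).1 ht
  have key : ((Λ.E.map ((f + g) ≫ γ).op).app (S.Q.obj Y)).hom (Λ.μ Z Y δ) =
      ((Λ.E.map (f ≫ γ).op).app (S.Q.obj Y)).hom (Λ.μ Z Y δ) +
        ((Λ.E.map (g ≫ γ).op).app (S.Q.obj Y)).hom (Λ.μ Z Y δ) := by
    have hinj : Function.Injective ((Λ.E.map (S.Q.map t).op).app (S.Q.obj Y)).hom :=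
      (ConcreteCategory.bijective_of_isIso ((Λ.E.map (S.Q.map t).op).app (S.Q.obj Y))).1
    apply hinj
    rw [map_add]
    have hc : ∀ (φ : S.Q.obj K' ⟶ S.Q.obj Z) (c : K₁ ⟶ Z), S.Q.map t ≫ φ = S.Q.map c →
        ((Λ.E.map (S.Q.map t).op).app (S.Q.obj Y)).hom
          (((Λ.E.map φ.op).app (S.Q.obj Y)).hom (Λ.μ Z Y δ)) = Λ.μ K₁ Y (pull c δ) := by
      intro φ c hφ
      rw [Λ.μ_pull, ← hφ, op_comp, Functor.map_comp, NatTrans.comp_app]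
      rfl
    rw [hc _ _ ha, hc _ _ hb, hc _ (a + b) (by
      rw [Preadditive.add_comp, Preadditive.comp_add, ha, hb, S.Q.map_add]), add_pull, map_add]
  change ((Λ.E.map (f + g).op).app A).hom _ =
    ((Λ.E.map f.op).app A).hom _ + ((Λ.E.map g.op).app A).hom _
  rw [nat, nat, nat, key, map_add]

/-- A sequence realizes an element of the localized bifunctor if it is isomorphic to the image of
an `𝔰`-triangle. -/
def IsReal {A B K : S.Localization} (x : A ⟶ B) (y : B ⟶ K) (e : (Λ.E.obj (op K)).obj A) : Prop :=
  ∃ (A₀ B₀ K₀ : C) (x₀ : A₀ ⟶ B₀) (y₀ : B₀ ⟶ K₀) (δ : X.Ext K₀ A₀) (α : A ≅ S.Q.obj A₀)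
    (β : B ≅ S.Q.obj B₀) (γ : K ≅ S.Q.obj K₀), X.IsTriangle x₀ y₀ δ ∧
    x ≫ β.hom = α.hom ≫ S.Q.map x₀ ∧ y ≫ γ.hom = β.hom ≫ S.Q.map y₀ ∧
    ((Λ.E.obj (op K)).map α.hom).hom e = ((Λ.E.map γ.hom.op).app _).hom (Λ.μ K₀ A₀ δ)

open Classical in
/-- The localized bifunctor with the realization by images of triangles. -/
noncomputable def str [Preadditive S.Localization] [S.Q.Additive] : ExtStructure S.Localization where
  E := Λ.E
  additive_left := Λ.additive_left h
  additive_right := Λ.additive_right h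
  real {K A} e := if H : ∃ p : ShortSeq A K, Λ.IsReal p.x p.y e then Quotient.mk _ H.choose
    else Quotient.mk _ ⟨A, 0, 0⟩

end Raw

section Structure

variable {C : Type u} [Category.{v} C] {pC : Preadditive C} [HasZeroObject C]
  [HasBinaryBiproducts C] {X : ExtStructure.{w} C} (hX : X.IsWeaklyExtriangulated)
  {S : MorphismProperty C} (h : HasQuotientCalculus S) (hT : IsCompatibleWithTriangles X S)
  (Λ : LocalizedExt X S) [Preadditive S.Localization] [S.Q.Additive]

/-- The natural transformation `μ`. -/
abbrev unit {K A : C} (δ : X.Ext K A) : (Λ.str h).Ext (S.Q.obj K) (S.Q.obj A) := Λ.μ K A δ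

lemma unit_push {K A A' : C} (a : A ⟶ A') (δ : X.Ext K A) :
    Λ.unit h (push a δ) = push (S.Q.map a) (Λ.unit h δ) := Λ.μ_push a δ

lemma unit_pull {K K' A : C} (c : K' ⟶ K) (δ : X.Ext K A) :
    Λ.unit h (pull c δ) = pull (S.Q.map c) (Λ.unit h δ) := Λ.μ_pull c δ

lemma unit_eq_zero_iff {K A : C} (δ : X.Ext K A) : Λ.unit h δ = 0 ↔ killed X S δ := by
  refine ⟨Λ.killed_of_eq_zero δ, fun hδ => ?_⟩
  obtain ⟨A', s, hs, hδ⟩ := (killed_iff h δ).1 hδ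
  have := (h.iff_isIso s).1 hs
  apply push_injective_of_isIso (S.Q.map s)
  rw [← unit_push, hδ, push_zero]
  exact map_zero _

lemma unit_eq_iff {K A : C} (δ δ' : X.Ext K A) :
    Λ.unit h δ = Λ.unit h δ' ↔ killed X S (δ - δ') := by
  rw [← unit_eq_zero_iff h Λ, ← sub_eq_zero]
  exact iff_of_eq (congrArg (· = 0) (map_sub (Λ.μ K A) δ δ').symm)

lemma exists_fraction {K A : C} (e : (Λ.str h).Ext (S.Q.obj K) (S.Q.obj A)) :
    ∃ (Z Y : C) (t : Z ⟶ K) (s : A ⟶ Y) (δ : X.Ext Z Y), S t ∧ S s ∧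
      pull (S.Q.map t) (push (S.Q.map s) e) = Λ.unit h δ := by
  obtain ⟨Z, Y, γ, α, δ, he⟩ := Λ.exists_rep e
  replace he : e = pull γ (push α (Λ.unit h δ)) := he
  obtain ⟨A', a, s, hs, ha⟩ := h.exists_left α
  obtain ⟨K', c, t, ht, hc⟩ := h.exists_right γ
  refine ⟨K', A', t, s, pull c (push a δ), ht, hs, ?_⟩
  rw [unit_pull, unit_push, ← hc, ← ha, he, ← pull_push, ← push_comp, ← pull_comp]

/-- Morphisms of extensions in the localization extend to morphisms between the images of
triangles. -/
lemma exists_hom_of_isTriangle (hX : X.IsWeaklyExtriangulated)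
    (hT : IsCompatibleWithTriangles X S) {A B K A' B' K' : C} {x : A ⟶ B} {y : B ⟶ K}
    {δ : X.Ext K A} {x' : A' ⟶ B'} {y' : B' ⟶ K'} {δ' : X.Ext K' A'} (hδ : X.IsTriangle x y δ)
    (hδ' : X.IsTriangle x' y' δ') (α : S.Q.obj A ⟶ S.Q.obj A') (γ : S.Q.obj K ⟶ S.Q.obj K')
    (e : push α (Λ.unit h δ) = pull γ (Λ.unit h δ')) :
    ∃ β : S.Q.obj B ⟶ S.Q.obj B', S.Q.map x ≫ β = α ≫ S.Q.map x' ∧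
      β ≫ S.Q.map y' = S.Q.map y ≫ γ ∧ (IsIso α → IsIso γ → IsIso β) := by
  obtain ⟨A₁, a, s, hs, ha, K₁, c, t, ht, hc, e'⟩ : ∃ (A₁ : C) (a : A ⟶ A₁) (s : A' ⟶ A₁)
      (_ : S s) (_ : α ≫ S.Q.map s = S.Q.map a) (K₁ : C) (c : K₁ ⟶ K') (t : K₁ ⟶ K) (_ : S t)
      (_ : S.Q.map t ≫ γ = S.Q.map c), push a (pull t δ) = pull c (push s δ') := by
    obtain ⟨A₁, a, s, hs, ha⟩ := h.exists_left α
    obtain ⟨K₁, c, t, ht, hc⟩ := h.exists_right γ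
    have e₁ : Λ.unit h (push a (pull t δ)) = Λ.unit h (pull c (push s δ')) := by
      rw [unit_push, unit_pull, unit_pull, unit_push, ← ha, ← hc, push_comp, pull_comp, pull_push,
        ← e, pull_push, pull_push]
    obtain ⟨A₂, s', hs', e₂⟩ := (killed_iff h _).1 ((unit_eq_iff h Λ _ _).1 e₁)
    refine ⟨A₂, a ≫ s', s ≫ s', h.comp_mem _ _ hs hs', ?_, K₁, c, t, ht, hc, ?_⟩
    · rw [S.Q.map_comp, S.Q.map_comp, reassoc_of% ha]
    · rw [push_sub, sub_eq_zero] at e₂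
      rw [push_comp, e₂, ← pull_push, push_comp]
  obtain ⟨B₁, x₁, y₁, h₁⟩ := exists_isTriangle (pull t δ)
  obtain ⟨B₂, x₂, y₂, h₂⟩ := exists_isTriangle (push s δ')
  obtain ⟨b₁, hb₁, hb₁'⟩ := hX.exists_hom h₁ hδ (𝟙 A) t (by simp)
  obtain ⟨b₂, hb₂, hb₂'⟩ := hX.exists_hom hδ' h₂ s (𝟙 K') (by simp)
  obtain ⟨b, hb, hb'⟩ := hX.exists_hom h₁ h₂ a c e'
  have i₁ := (h.iff_isIso _).1 (hT h₁ hδ _ _ _ (by simp) hb₁ hb₁' (h.id_mem A) ht)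
  have i₂ := (h.iff_isIso _).1 (hT hδ' h₂ _ _ _ (by simp) hb₂ hb₂' hs (h.id_mem K'))
  have is := (h.iff_isIso _).1 hs
  have it := (h.iff_isIso _).1 ht
  refine ⟨inv (S.Q.map b₁) ≫ S.Q.map b ≫ inv (S.Q.map b₂), ?_, ?_, fun hα hγ => ?_⟩
  · have q₁ : S.Q.map x ≫ inv (S.Q.map b₁) = S.Q.map x₁ := by
      rw [IsIso.comp_inv_eq, ← S.Q.map_comp, hb₁, Category.id_comp]
    have q₂ : S.Q.map x₂ ≫ inv (S.Q.map b₂) = inv (S.Q.map s) ≫ S.Q.map x' := by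
      rw [IsIso.comp_inv_eq, Category.assoc, ← S.Q.map_comp, hb₂, S.Q.map_comp,
        IsIso.inv_hom_id_assoc]
    rw [reassoc_of% q₁, ← S.Q.map_comp_assoc, hb, S.Q.map_comp, Category.assoc, q₂, ← ha]
    simp
  · have q₁ : inv (S.Q.map b₂) ≫ S.Q.map y' = S.Q.map y₂ := by
      rw [IsIso.inv_comp_eq, ← S.Q.map_comp, hb₂', Category.comp_id]
    have q₂ : inv (S.Q.map b₁) ≫ S.Q.map y₁ = S.Q.map y ≫ inv (S.Q.map t) := by
      rw [IsIso.inv_comp_eq, ← Category.assoc, ← S.Q.map_comp, hb₁', S.Q.map_comp, Category.assoc,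
        IsIso.hom_inv_id, Category.comp_id]
    rw [Category.assoc, Category.assoc, q₁, ← S.Q.map_comp, hb', S.Q.map_comp, reassoc_of% q₂,
      ← hc, IsIso.inv_hom_id_assoc]
  · have haS : S a := by rw [h.iff_isIso, ← ha]; infer_instance
    have hcS : S c := by rw [h.iff_isIso, ← hc]; infer_instance
    have := (h.iff_isIso _).1 (hT h₁ h₂ _ _ _ e' hb hb' haS hcS)
    infer_instance

lemma IsReal.exists_iso {Λ : LocalizedExt X S} (hX : X.IsWeaklyExtriangulated)
    (hT : IsCompatibleWithTriangles X S) (h : HasQuotientCalculus S) {A B B' K : S.Localization}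
    {x : A ⟶ B} {y : B ⟶ K} {x' : A ⟶ B'} {y' : B' ⟶ K} {e : (Λ.E.obj (op K)).obj A}
    (he : Λ.IsReal x y e) (he' : Λ.IsReal x' y' e) :
    ∃ b : B ≅ B', x ≫ b.hom = x' ∧ b.hom ≫ y' = y := by
  obtain ⟨A₀, B₀, K₀, x₀, y₀, δ, α, β, γ, hδ, hx, hy, e₀⟩ := he
  obtain ⟨A₁, B₁, K₁, x₁, y₁, δ₁, α₁, β₁, γ₁, hδ₁, hx₁, hy₁, e₁⟩ := he'
  let e : (Λ.str h).Ext K A := e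
  replace e₀ : push α.hom e = pull γ.hom (Λ.unit h δ) := e₀
  replace e₁ : push α₁.hom e = pull γ₁.hom (Λ.unit h δ₁) := e₁
  obtain ⟨b, hb, hb', hi⟩ := exists_hom_of_isTriangle h Λ hX hT hδ hδ₁ (α.inv ≫ α₁.hom)
    (γ.inv ≫ γ₁.hom) (by
      rw [pull_comp, ← e₁, push_comp, pull_push]
      congr 1
      apply pull_injective_of_isIso γ.hom
      rw [pull_push, ← e₀, ← push_comp, ← pull_comp]
      simp)
  have := hi inferInstance inferInstance
  refine ⟨β ≪≫ asIso b ≪≫ β₁.symm, ?_, ?_⟩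
  · have hx₁' : α₁.hom ≫ S.Q.map x₁ ≫ β₁.inv = x' := by
      rw [← Category.assoc, ← hx₁]; simp
    simp [reassoc_of% hx, reassoc_of% hb, hx₁']
  · have hy₁' : β₁.inv ≫ y' = S.Q.map y₁ ≫ γ₁.inv := by
      rw [Iso.inv_comp_eq, ← Category.assoc, ← hy₁]; simp
    simp [hy₁', reassoc_of% hb', ← reassoc_of% hy]

lemma isReal_of_fraction {K A Z Y B : C} {e : (Λ.str h).Ext (S.Q.obj K) (S.Q.obj A)}
    {t : Z ⟶ K} {s : A ⟶ Y} {δ : X.Ext Z Y} (ht : S t) (hs : S s)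
    (he : pull (S.Q.map t) (push (S.Q.map s) e) = Λ.unit h δ) {x : Y ⟶ B} {y : B ⟶ Z}
    (hδ : X.IsTriangle x y δ) : Λ.IsReal (S.Q.map (s ≫ x)) (S.Q.map (y ≫ t)) e := by
  have := (h.iff_isIso s).1 hs
  have := (h.iff_isIso t).1 ht
  refine ⟨_, _, _, x, y, δ, asIso (S.Q.map s), Iso.refl _, (asIso (S.Q.map t)).symm, hδ, by simp,
    by simp, ?_⟩
  change push (S.Q.map s) e = pull (inv (S.Q.map t)) (Λ.unit h δ)
  rw [← he, ← pull_comp]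
  simp

lemma exists_isReal {K A : S.Localization} (e : (Λ.str h).Ext K A) :
    ∃ (B : S.Localization) (x : A ⟶ B) (y : B ⟶ K), Λ.IsReal x y e := by
  obtain ⟨A, rfl⟩ := exists_obj_eq A
  obtain ⟨K, rfl⟩ := exists_obj_eq K
  obtain ⟨Z, Y, t, s, δ, ht, hs, he⟩ := exists_fraction h Λ e
  obtain ⟨B, x, y, hδ⟩ := exists_isTriangle δ
  exact ⟨_, _, _, isReal_of_fraction h Λ ht hs he hδ⟩

include hX hT

lemma isTriangle_str_iff {A B K : S.Localization} (x : A ⟶ B) (y : B ⟶ K)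
    (e : (Λ.str h).Ext K A) : (Λ.str h).IsTriangle x y e ↔ Λ.IsReal x y e := by
  obtain ⟨B', x', y', he⟩ := exists_isReal h Λ e
  have H : ∃ p : ShortSeq A K, Λ.IsReal p.x p.y e := ⟨⟨B', x', y'⟩, he⟩
  have hr : (Λ.str h).real e = seqClass H.choose.x H.choose.y := dif_pos H
  rw [IsTriangle, hr, seqClass_eq_iff]
  constructor
  · rintro ⟨b, rfl, hb⟩
    obtain ⟨A₀, B₀, K₀, x₀, y₀, δ, α, β, γ, hδ, hx, hy, e₀⟩ := H.choose_spec
    refine ⟨A₀, B₀, K₀, x₀, y₀, δ, α, b.symm ≪≫ β, γ, hδ, by simp [hx], ?_, e₀⟩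
    rw [← cancel_epi b.hom]
    simp [reassoc_of% hb, hy]
  · intro he'
    exact IsReal.exists_iso hX hT h H.choose_spec he'

end Structure

end LocalizedExt

section BiprodIso

variable {C : Type u} [Category.{v} C] [Preadditive C] [HasBinaryBiproducts C]
  {D : Type u'} [Category.{v'} D] [Preadditive D] [HasBinaryBiproducts D] (G : C ⥤ D)
  [G.Additive]

/-- An additive functor preserves biproducts up to isomorphism. -/
noncomputable def biprodIso {A B : C} {A' B' : D} (f : A' ≅ G.obj A) (g : B' ≅ G.obj B) :
    A' ⊞ B' ≅ G.obj (A ⊞ B) where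
  hom := biprod.desc (f.hom ≫ G.map biprod.inl) (g.hom ≫ G.map biprod.inr)
  inv := biprod.lift (G.map biprod.fst ≫ f.inv) (G.map biprod.snd ≫ g.inv)
  hom_inv_id := by
    ext <;> simp [← G.map_comp_assoc]
  inv_hom_id := by
    rw [biprod.lift_desc, Category.assoc, Category.assoc, Iso.inv_hom_id_assoc,
      Iso.inv_hom_id_assoc, ← G.map_comp, ← G.map_comp, ← G.map_add, biprod.total, G.map_id]

variable {A B : C} {A' B' : D} (f : A' ≅ G.obj A) (g : B' ≅ G.obj B)

lemma lift_comp_biprodIso_hom {T : C} {T' : D} {u : T' ⟶ G.obj T} {a : T ⟶ A} {b : T ⟶ B}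
    {a' : T' ⟶ A'} {b' : T' ⟶ B'} (ha : a' ≫ f.hom = u ≫ G.map a)
    (hb : b' ≫ g.hom = u ≫ G.map b) :
    biprod.lift a' b' ≫ (biprodIso G f g).hom = u ≫ G.map (biprod.lift a b) := by
  rw [biprod.lift_eq (f := a), G.map_add, G.map_comp, G.map_comp, Preadditive.comp_add,
    ← reassoc_of% ha, ← reassoc_of% hb]
  simp [biprodIso]

lemma desc_comp_eq_biprodIso_hom {T : C} {T' : D} {u : T' ⟶ G.obj T} {a : A ⟶ T} {b : B ⟶ T}
    {a' : A' ⟶ T'} {b' : B' ⟶ T'} (ha : a' ≫ u = f.hom ≫ G.map a)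
    (hb : b' ≫ u = g.hom ≫ G.map b) :
    biprod.desc a' b' ≫ u = (biprodIso G f g).hom ≫ G.map (biprod.desc a b) := by
  ext
  · simp [biprodIso, ha, ← G.map_comp]
  · simp [biprodIso, hb, ← G.map_comp]

end BiprodIso

namespace LocalizedExt

section Weak

variable {C : Type u} [Category.{v} C] {pC : Preadditive C} [HasZeroObject C]
  [HasBinaryBiproducts C] {X : ExtStructure.{w} C} (hX : X.IsWeaklyExtriangulated)
  {S : MorphismProperty C} (h : HasQuotientCalculus S) (hT : IsCompatibleWithTriangles X S)
  (Λ : LocalizedExt X S) [Preadditive S.Localization] [S.Q.Additive]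

section Exactness

variable {A B K : C} {x : A ⟶ B} {y : B ⟶ K} {δ : X.Ext K A} (hδ : X.IsTriangle x y δ)
include hX hT hδ

include h in
lemma exists_Q_lift_x {T : C} (f : S.Q.obj T ⟶ S.Q.obj B) (hf : f ≫ S.Q.map y = 0) :
    ∃ g : S.Q.obj T ⟶ S.Q.obj A, g ≫ S.Q.map x = f := by
  obtain ⟨T₁, g, t, ht, hg⟩ := h.exists_right f
  obtain ⟨T₂, t', ht', e⟩ := h.exists_precomp (g ≫ y) 0 (by
    rw [S.Q.map_comp, ← hg, Category.assoc, hf, comp_zero, S.Q.map_zero])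
  obtain ⟨N, hN, i, j, e⟩ := (h.functor_map_eq_iff _ _).1 e.symm
  rw [comp_zero, zero_add, ← Category.assoc] at e
  have hk : killed X S (pull j δ) := killed_of_pull_eq_zero hX h hT _
    (hN _ (isZero_zero C)).2 (by rw [← pull_comp, zero_comp, zero_pull])
  obtain ⟨A', s, hs, hk⟩ := (killed_iff h _).1 hk
  obtain ⟨B', x', y', hδ'⟩ := exists_isTriangle (push s δ)
  obtain ⟨b, hb, hb'⟩ := hX.exists_hom hδ hδ' s (𝟙 K) (by simp)
  have := (h.iff_isIso _).1 (hT hδ hδ' s b (𝟙 K) (by simp) hb hb' hs (h.id_mem K))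
  have := (h.iff_isIso _).1 hs
  have := (h.iff_isIso _).1 ht
  have := (h.iff_isIso _).1 ht'
  obtain ⟨k, hk⟩ := hX.exists_lift_y hδ' j (by rw [pull_push, hk])
  obtain ⟨l, hl⟩ := hX.exists_lift_x hδ' ((t' ≫ g) ≫ b - i ≫ k) (by
    rw [Preadditive.sub_comp, Category.assoc, hb', Category.comp_id, e, Category.assoc, hk,
      sub_self])
  have hik : S.Q.map (i ≫ k) = 0 := by
    rw [h.map_eq _ _ (i ≫ k) 0 ⟨N, hN, i, -k, by simp⟩, S.Q.map_zero]
  have hl' : S.Q.map l ≫ S.Q.map x' = S.Q.map t' ≫ S.Q.map g ≫ S.Q.map b := by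
    rw [← S.Q.map_comp, hl, S.Q.map_sub, hik, sub_zero, S.Q.map_comp, S.Q.map_comp, Category.assoc]
  have hx : inv (S.Q.map s) ≫ S.Q.map x = S.Q.map x' ≫ inv (S.Q.map b) := by
    rw [IsIso.inv_comp_eq, ← Category.assoc, IsIso.eq_comp_inv, ← S.Q.map_comp, hb, S.Q.map_comp]
  refine ⟨inv (S.Q.map t) ≫ inv (S.Q.map t') ≫ S.Q.map l ≫ inv (S.Q.map s), ?_⟩
  rw [Category.assoc, Category.assoc, Category.assoc, hx, reassoc_of% hl', ← hg]
  simp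

include h in
lemma exists_Q_desc_y {T : C} (f : S.Q.obj B ⟶ S.Q.obj T) (hf : S.Q.map x ≫ f = 0) :
    ∃ g : S.Q.obj K ⟶ S.Q.obj T, S.Q.map y ≫ g = f := by
  obtain ⟨T₁, g, t, ht, hg⟩ := h.exists_left f
  obtain ⟨T₂, t', ht', e⟩ := h.exists_postcomp (x ≫ g) 0 (by
    rw [S.Q.map_comp, ← hg, reassoc_of% hf, zero_comp, S.Q.map_zero])
  obtain ⟨N, hN, i, j, e⟩ := (h.functor_map_eq_iff _ _).1 e.symm
  rw [zero_comp, zero_add, Category.assoc] at e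
  have hk : killed X S (push i δ) := killed_of_push_eq_zero h _
    (hN _ (isZero_zero C)).1 (by rw [← push_comp, comp_zero, zero_push])
  obtain ⟨K', s, hs, hk⟩ := exists_pull_eq_zero hX h hT hk
  obtain ⟨B', x', y', hδ'⟩ := exists_isTriangle (pull s δ)
  obtain ⟨b, hb, hb'⟩ := hX.exists_hom hδ' hδ (𝟙 A) s (by simp)
  have := (h.iff_isIso _).1 (hT hδ' hδ (𝟙 A) b s (by simp) hb hb' (h.id_mem A) hs)
  have := (h.iff_isIso _).1 hs
  have := (h.iff_isIso _).1 ht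
  have := (h.iff_isIso _).1 ht'
  obtain ⟨k, hk⟩ := hX.exists_desc_x hδ' i (by rw [← pull_push, hk])
  obtain ⟨l, hl⟩ := hX.exists_desc_y hδ' (b ≫ g ≫ t' - k ≫ j) (by
    rw [Preadditive.comp_sub, reassoc_of% hb, e, reassoc_of% hk, sub_self])
  have hik : S.Q.map (k ≫ j) = 0 := by
    rw [h.map_eq _ _ (k ≫ j) 0 ⟨N, hN, k, -j, by simp⟩, S.Q.map_zero]
  have hl' : S.Q.map y' ≫ S.Q.map l = S.Q.map b ≫ S.Q.map g ≫ S.Q.map t' := by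
    rw [← S.Q.map_comp, hl, S.Q.map_sub, hik, sub_zero, S.Q.map_comp, S.Q.map_comp]
  have hy : S.Q.map y ≫ inv (S.Q.map s) = inv (S.Q.map b) ≫ S.Q.map y' := by
    rw [IsIso.comp_inv_eq, Category.assoc, IsIso.eq_inv_comp, ← S.Q.map_comp, hb', S.Q.map_comp]
  refine ⟨inv (S.Q.map s) ≫ S.Q.map l ≫ inv (S.Q.map t') ≫ inv (S.Q.map t), ?_⟩
  rw [reassoc_of% hy, reassoc_of% hl', ← hg]
  simp

lemma exists_Q_lift_y {T : C} (f : S.Q.obj T ⟶ S.Q.obj K)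
    (hf : pull f (Λ.unit h δ) = 0) : ∃ g : S.Q.obj T ⟶ S.Q.obj B, g ≫ S.Q.map y = f := by
  obtain ⟨T₁, g, t, ht, hg⟩ := h.exists_right f
  have hk : killed X S (pull g δ) := by
    rw [← unit_eq_zero_iff h Λ, unit_pull, ← hg, pull_comp, hf, pull_zero]
  obtain ⟨T₂, t', ht', hk⟩ := exists_pull_eq_zero hX h hT hk
  obtain ⟨l, hl⟩ := hX.exists_lift_y hδ (t' ≫ g) (by rw [pull_comp, hk])
  have := (h.iff_isIso _).1 ht
  have := (h.iff_isIso _).1 ht'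
  refine ⟨inv (S.Q.map t) ≫ inv (S.Q.map t') ≫ S.Q.map l, ?_⟩
  rw [Category.assoc, Category.assoc, ← S.Q.map_comp, hl, S.Q.map_comp, ← hg]
  simp

lemma exists_Q_desc_x {T : C} (f : S.Q.obj A ⟶ S.Q.obj T)
    (hf : push f (Λ.unit h δ) = 0) : ∃ g : S.Q.obj B ⟶ S.Q.obj T, S.Q.map x ≫ g = f := by
  obtain ⟨T₁, g, t, ht, hg⟩ := h.exists_left f
  have hk : killed X S (push g δ) := by
    rw [← unit_eq_zero_iff h Λ, unit_push, ← hg, push_comp, hf, push_zero]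
  obtain ⟨T₂, t', ht', hk⟩ := (killed_iff h _).1 hk
  obtain ⟨l, hl⟩ := hX.exists_desc_x hδ (g ≫ t') (by rw [push_comp, hk])
  have := (h.iff_isIso _).1 ht
  have := (h.iff_isIso _).1 ht'
  refine ⟨S.Q.map l ≫ inv (S.Q.map t') ≫ inv (S.Q.map t), ?_⟩
  rw [← Category.assoc, ← S.Q.map_comp, hl, S.Q.map_comp, Category.assoc, ← hg]
  simp

end Exactness

include hX hT in
lemma isWeaklyExtriangulated_str [HasBinaryBiproducts S.Localization] :
    (Λ.str h).IsWeaklyExtriangulated where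
  c1_mid {A B K} x y e he T f := by
    rw [isTriangle_str_iff hX h hT Λ] at he
    obtain ⟨A₀, B₀, K₀, x₀, y₀, δ, α, β, γ, hδ, hx, hy, -⟩ := he
    obtain ⟨T, rfl⟩ := exists_obj_eq T
    constructor
    · intro hf
      obtain ⟨g, hg⟩ := exists_Q_lift_x hX h hT hδ (f ≫ β.hom) (by
        rw [Category.assoc, ← hy, reassoc_of% hf, zero_comp])
      refine ⟨g ≫ α.inv, ?_⟩
      dsimp only
      rw [← cancel_mono β.hom, ← hg, Category.assoc, Category.assoc, hx, Iso.inv_hom_id_assoc]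
    · rintro ⟨g, rfl⟩
      dsimp only
      rw [← cancel_mono γ.hom, Category.assoc, Category.assoc, hy, reassoc_of% hx,
        ← S.Q.map_comp, hX.comp_eq_zero hδ]
      simp
  c1_right {A B K} x y e he T f := by
    rw [isTriangle_str_iff hX h hT Λ] at he
    obtain ⟨A₀, B₀, K₀, x₀, y₀, δ, α, β, γ, hδ, hx, hy, he⟩ := he
    replace he : push α.hom e = pull γ.hom (Λ.unit h δ) := he
    obtain ⟨T, rfl⟩ := exists_obj_eq T
    constructor
    · intro hf
      obtain ⟨g, hg⟩ := exists_Q_lift_y hX h hT Λ hδ (f ≫ γ.hom) (by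
        rw [pull_comp, ← he, pull_push]
        exact (congrArg (push α.hom) hf).trans (push_zero _))
      refine ⟨g ≫ β.inv, ?_⟩
      dsimp only
      rw [← cancel_mono γ.hom, ← hg, Category.assoc, Category.assoc, hy, Iso.inv_hom_id_assoc]
    · rintro ⟨g, rfl⟩
      apply push_injective_of_isIso α.hom
      rw [push_zero, ← pull_push, he, ← pull_comp, Category.assoc, hy, pull_comp, pull_comp,
        ← unit_pull, hX.pull_eq_zero hδ, (unit_eq_zero_iff h Λ _).2 (killed_zero h), pull_zero,
        pull_zero]
  c1op_mid {A B K} x y e he T f := by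
    rw [isTriangle_str_iff hX h hT Λ] at he
    obtain ⟨A₀, B₀, K₀, x₀, y₀, δ, α, β, γ, hδ, hx, hy, -⟩ := he
    obtain ⟨T, rfl⟩ := exists_obj_eq T
    constructor
    · intro hf
      obtain ⟨g, hg⟩ := exists_Q_desc_y hX h hT hδ (β.inv ≫ f) (by
        rw [← cancel_epi α.hom, ← reassoc_of% hx, Iso.hom_inv_id_assoc, comp_zero]
        exact hf)
      refine ⟨γ.hom ≫ g, ?_⟩
      dsimp only
      rw [reassoc_of% hy, hg, Iso.hom_inv_id_assoc]
    · rintro ⟨g, rfl⟩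
      dsimp only
      have hxy : x ≫ y = 0 := by
        rw [← cancel_mono γ.hom, Category.assoc, hy, reassoc_of% hx, ← S.Q.map_comp,
          hX.comp_eq_zero hδ]
        simp
      rw [reassoc_of% hxy, zero_comp]
  c1op_left {A B K} x y e he T f := by
    rw [isTriangle_str_iff hX h hT Λ] at he
    obtain ⟨A₀, B₀, K₀, x₀, y₀, δ, α, β, γ, hδ, hx, hy, he⟩ := he
    replace he : push α.hom e = pull γ.hom (Λ.unit h δ) := he
    obtain ⟨T, rfl⟩ := exists_obj_eq T
    constructor
    · intro hf
      replace hf : push f e = 0 := hf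
      obtain ⟨g, hg⟩ := exists_Q_desc_x hX h hT Λ hδ (α.inv ≫ f) (by
        apply pull_injective_of_isIso γ.hom
        rw [pull_push, ← he, ← push_comp, Iso.hom_inv_id_assoc, hf, pull_zero])
      refine ⟨β.hom ≫ g, ?_⟩
      dsimp only
      rw [reassoc_of% hx, hg, Iso.hom_inv_id_assoc]
    · rintro ⟨g, rfl⟩
      have hxe : push x e = 0 := by
        apply push_injective_of_isIso β.hom
        rw [push_zero, ← push_comp, hx, push_comp, he, ← pull_push, ← unit_push,
          hX.push_eq_zero hδ, (unit_eq_zero_iff h Λ _).2 (killed_zero h), pull_zero]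
      exact push_comp_eq_zero x g e hxe
  c2 A Z hZ := by
    rw [isTriangle_str_iff hX h hT Λ]
    obtain ⟨A, rfl⟩ := exists_obj_eq A
    refine ⟨_, _, _, _, _, _, Iso.refl _, Iso.refl _, hZ.iso (S.Q.map_isZero (isZero_zero C)),
      hX.c2 A _ (isZero_zero C), by simp, by simp, ?_⟩
    exact (map_zero _).trans ((congrArg _ (map_zero (Λ.μ _ _))).trans (map_zero _)).symm
  c2op A Z hZ := by
    rw [isTriangle_str_iff hX h hT Λ]
    obtain ⟨A, rfl⟩ := exists_obj_eq A
    refine ⟨_, _, _, _, _, _, hZ.iso (S.Q.map_isZero (isZero_zero C)), Iso.refl _, Iso.refl _,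
      hX.c2op A _ (isZero_zero C), by simp, by simp, ?_⟩
    exact (map_zero _).trans ((congrArg _ (map_zero (Λ.μ _ _))).trans (map_zero _)).symm
  c3 {A A' B B' K} x y e a' x' y' he he' := by
    rw [isTriangle_str_iff hX h hT Λ] at he he'
    obtain ⟨A₀, B₀, K₀, x₀, y₀, δ, α, β, γ, hδ, hx, hy, he⟩ := he
    replace he : push α.hom e = pull γ.hom (Λ.unit h δ) := he
    obtain ⟨A', rfl⟩ := exists_obj_eq A'
    obtain ⟨A₁, a, s, hs, ha⟩ := h.exists_left (α.inv ≫ a')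
    have := (h.iff_isIso _).1 hs
    rw [Category.assoc, Iso.inv_comp_eq] at ha
    obtain ⟨B₁, x₁, y₁, hδ₁⟩ := exists_isTriangle (push a δ)
    obtain ⟨b, hb, hb', hcone⟩ := hX.c3 x₀ y₀ δ a x₁ y₁ hδ hδ₁
    have hr : Λ.IsReal (S.Q.map s ≫ S.Q.map x₁) (S.Q.map y₁ ≫ γ.inv) (push (X := Λ.str h) a' e) := by
      refine ⟨_, _, _, _, _, _, asIso (S.Q.map s), Iso.refl _, γ, hδ₁, by simp, by simp, ?_⟩
      change push (S.Q.map s) (push (X := Λ.str h) a' e) = pull γ.hom (Λ.unit h _)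
      rw [← push_comp, ha, push_comp, he, unit_push, pull_push]
    obtain ⟨θ, hθ, hθ'⟩ := IsReal.exists_iso hX hT h he' hr
    have hy' : y' ≫ γ.hom = θ.hom ≫ S.Q.map y₁ := by rw [← hθ']; simp
    have hx' : S.Q.map s ≫ S.Q.map x₁ ≫ θ.inv = x' := by
      rw [← Category.assoc, ← hθ]; simp
    refine ⟨β.hom ≫ S.Q.map b ≫ θ.inv, ?_, ?_, ?_⟩
    · rw [reassoc_of% hx, ← S.Q.map_comp_assoc, hb, S.Q.map_comp, Category.assoc, ← reassoc_of% ha,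
        hx']
    · have : θ.inv ≫ y' = S.Q.map y₁ ≫ γ.inv := by rw [Iso.inv_comp_eq, hθ']
      rw [Category.assoc, Category.assoc, this, ← S.Q.map_comp_assoc, hb', ← reassoc_of% hy]
      simp
    · rw [isTriangle_str_iff hX h hT Λ]
      refine ⟨_, _, _, _, _, _, α, biprodIso S.Q β (asIso (S.Q.map s)), θ, hcone,
        lift_comp_biprodIso_hom S.Q _ _ hx (ha.trans ?_),
        desc_comp_eq_biprodIso_hom S.Q _ _ ?_ ?_, ?_⟩
      · rfl
      · rw [Category.assoc, Category.assoc, Iso.inv_hom_id, Category.comp_id]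
      · rw [← hx', S.Q.map_neg, Preadditive.neg_comp, Preadditive.comp_neg, Category.assoc,
          Category.assoc, Iso.inv_hom_id, Category.comp_id]
        rfl
      · change push α.hom (pull (X := Λ.str h) y' e) = pull θ.hom (Λ.unit h _)
        rw [← pull_push, he, ← pull_comp, hy', pull_comp, unit_pull]
  c3op {A B B' K K'} x y e c' x' y' he he' := by
    rw [isTriangle_str_iff hX h hT Λ] at he he'
    obtain ⟨A₀, B₀, K₀, x₀, y₀, δ, α, β, γ, hδ, hx, hy, he⟩ := he
    replace he : push α.hom e = pull γ.hom (Λ.unit h δ) := he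
    obtain ⟨K', rfl⟩ := exists_obj_eq K'
    obtain ⟨K₁, c, t, ht, hc⟩ := h.exists_right (c' ≫ γ.hom)
    have := (h.iff_isIso _).1 ht
    obtain ⟨B₁, x₁, y₁, hδ₁⟩ := exists_isTriangle (pull c δ)
    obtain ⟨b, hb, hb', hcone⟩ := hX.c3op x₀ y₀ δ c x₁ y₁ hδ hδ₁
    have hr : Λ.IsReal (α.hom ≫ S.Q.map x₁) (S.Q.map y₁ ≫ S.Q.map t)
        (pull (X := Λ.str h) c' e) := by
      refine ⟨_, _, _, _, _, _, α, Iso.refl _, (asIso (S.Q.map t)).symm, hδ₁, by simp, by simp, ?_⟩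
      change push α.hom (pull (X := Λ.str h) c' e) = pull (inv (S.Q.map t)) (Λ.unit h _)
      rw [← pull_push, he, unit_pull, ← hc, ← pull_comp, ← pull_comp]
      simp
    obtain ⟨θ, hθ, hθ'⟩ := IsReal.exists_iso hX hT h he' hr
    have hc' : S.Q.map c ≫ γ.inv = S.Q.map t ≫ c' := by rw [← hc]; simp
    have hx' : x' ≫ θ.hom = α.hom ≫ S.Q.map x₁ := hθ
    have hy' : y' ≫ inv (S.Q.map t) = θ.hom ≫ S.Q.map y₁ := by rw [← hθ']; simp
    have hy₀ : β.inv ≫ y = S.Q.map y₀ ≫ γ.inv := by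
      rw [Iso.inv_comp_eq, ← reassoc_of% hy]; simp
    have hx₀ : x = α.hom ≫ S.Q.map x₀ ≫ β.inv := by rw [← reassoc_of% hx]; simp
    refine ⟨θ.hom ≫ S.Q.map b ≫ β.inv, ?_, ?_, ?_⟩
    · rw [reassoc_of% hx', ← S.Q.map_comp_assoc, hb, hx₀]
    · rw [Category.assoc, Category.assoc, hy₀, ← S.Q.map_comp_assoc, hb', S.Q.map_comp,
        Category.assoc, hc', ← hθ', Category.assoc, Category.assoc]
    · rw [isTriangle_str_iff hX h hT Λ]
      refine ⟨_, _, _, _, _, _, θ, biprodIso S.Q (asIso (S.Q.map t)).symm β, γ, hcone,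
        lift_comp_biprodIso_hom S.Q _ _ ?_ ?_,
        desc_comp_eq_biprodIso_hom S.Q _ _ ?_ hy, ?_⟩
      · rw [S.Q.map_neg, Preadditive.neg_comp, Preadditive.comp_neg, ← hy']
        rfl
      · rw [Category.assoc, Category.assoc, Iso.inv_hom_id, Category.comp_id]
      · rw [← hc]
        exact ((asIso (S.Q.map t)).inv_hom_id_assoc _).symm
      · change push θ.hom (push (X := Λ.str h) x' e) = pull γ.hom (Λ.unit h _)
        rw [← push_comp, hx', push_comp, he, unit_push, pull_push]

end Weak

end LocalizedExt

namespace LocalizedExt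

section Frac

variable {C : Type u} [Category.{v} C] {pC : Preadditive C} [HasZeroObject C]
  [HasBinaryBiproducts C] {X : ExtStructure.{w} C} (hX : X.IsWeaklyExtriangulated)
  {S : MorphismProperty C} (h : HasQuotientCalculus S) (hT : IsCompatibleWithTriangles X S)
  (Λ : LocalizedExt X S) [Preadditive S.Localization] [S.Q.Additive]

include h in
lemma isIso_of_sSat {A B : C} {s : A ⟶ B} (hs : sSat S s) : IsIso (S.Q.map s) :=
  (h.iff_isIso s).1 ((h.sSat_iff s).1 hs)

/-- The extension defined by a triplet `(t \ δ / s)`. -/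
noncomputable def ofTriplet {K A : C} (a : Triplet X S K A) :
    (Λ.str h).Ext (S.Q.obj K) (S.Q.obj A) :=
  haveI := isIso_of_sSat h a.ht
  haveI := isIso_of_sSat h a.hs
  pull (inv (S.Q.map a.t)) (push (inv (S.Q.map a.s)) (Λ.unit h a.δ))

lemma pull_push_injective {K K' A A' : C} {t : K' ⟶ K} {s : A ⟶ A'} (ht : sSat S t)
    (hs : sSat S s) {e e' : (Λ.str h).Ext (S.Q.obj K) (S.Q.obj A)}
    (he : pull (S.Q.map t) (push (S.Q.map s) e) = pull (S.Q.map t) (push (S.Q.map s) e')) :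
    e = e' := by
  have := isIso_of_sSat h ht
  have := isIso_of_sSat h hs
  exact push_injective_of_isIso _ (pull_injective_of_isIso _ he)

lemma pull_push_ofTriplet {K A : C} (a : Triplet X S K A) :
    pull (S.Q.map a.t) (push (S.Q.map a.s) (Λ.ofTriplet h a)) = Λ.unit h a.δ := by
  have := isIso_of_sSat h a.ht
  have := isIso_of_sSat h a.hs
  rw [ofTriplet, pull_push, ← pull_comp, IsIso.hom_inv_id, pull_id, ← push_comp,
    IsIso.inv_hom_id, push_id]

lemma ofTriplet_eq_iff {K A : C} (a : Triplet X S K A)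
    (e : (Λ.str h).Ext (S.Q.obj K) (S.Q.obj A)) :
    Λ.ofTriplet h a = e ↔ pull (S.Q.map a.t) (push (S.Q.map a.s) e) = Λ.unit h a.δ := by
  refine ⟨?_, fun he => pull_push_injective h Λ a.ht a.hs ?_⟩
  · rintro rfl
    exact pull_push_ofTriplet h Λ a
  · rw [pull_push_ofTriplet, he]

lemma pull_push_comp_ofTriplet {K A : C} (a : Triplet X S K A) {Z Y : C} {t : Z ⟶ K} {s : A ⟶ Y}
    (v : Z ⟶ a.Z) (r : a.Y ⟶ Y) (ht : S.Q.map t = S.Q.map (v ≫ a.t))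
    (hs : S.Q.map s = S.Q.map (a.s ≫ r)) :
    pull (S.Q.map t) (push (S.Q.map s) (Λ.ofTriplet h a)) =
      Λ.unit h (pull v (push r a.δ)) := by
  rw [ht, hs, unit_pull, unit_push, ← pull_push_ofTriplet, S.Q.map_comp, S.Q.map_comp, pull_comp,
    push_comp, ← pull_push]

lemma ofTriplet_eq_of_rel {K A : C} (a b : Triplet X S K A) (hab : a.Rel b) :
    Λ.ofTriplet h a = Λ.ofTriplet h b := by
  obtain ⟨Z, Y, t, s, v₁, v₂, u₁, u₂, ht, hs, -, -, -, -, e₁, e₂, e₃, e₄, hk⟩ := hab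
  refine pull_push_injective h Λ ht hs ?_
  rw [pull_push_comp_ofTriplet h Λ a v₁ u₁ (h.map_eq' _ _ e₃) (h.map_eq' _ _ e₁),
    pull_push_comp_ofTriplet h Λ b v₂ u₂ (h.map_eq' _ _ e₄) (h.map_eq' _ _ e₂),
    unit_eq_iff]
  exact hk

lemma rel_of_ofTriplet_eq {K A : C} (a b : Triplet X S K A)
    (hab : Λ.ofTriplet h a = Λ.ofTriplet h b) : a.Rel b := by
  have := isIso_of_sSat h a.ht
  have := isIso_of_sSat h a.hs
  have := isIso_of_sSat h b.ht
  have := isIso_of_sSat h b.hs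
  obtain ⟨Z, v₁, v₂, hv₁, hv₂, ev⟩ : ∃ (Z : C) (v₁ : Z ⟶ a.Z) (v₂ : Z ⟶ b.Z), S v₁ ∧ S v₂ ∧
      (quotFunctor S).map (v₁ ≫ a.t) = (quotFunctor S).map (v₂ ≫ b.t) := by
    obtain ⟨Z, v₂, v₁, hv₁, e⟩ := h.exists_right (S.Q.map a.t ≫ inv (S.Q.map b.t))
    have := (h.iff_isIso _).1 hv₁
    have hv₂ : S v₂ := by rw [h.iff_isIso, ← e]; infer_instance
    rw [← Category.assoc, IsIso.comp_inv_eq, ← S.Q.map_comp, ← S.Q.map_comp] at e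
    obtain ⟨Z', z, hz, e⟩ := h.exists_precomp _ _ e
    exact ⟨Z', z ≫ v₁, z ≫ v₂, h.comp_mem _ _ hz hv₁, h.comp_mem _ _ hz hv₂, by simpa using e⟩
  obtain ⟨Y, u₁, u₂, hu₁, hu₂, eu⟩ : ∃ (Y : C) (u₁ : a.Y ⟶ Y) (u₂ : b.Y ⟶ Y), S u₁ ∧ S u₂ ∧
      (quotFunctor S).map (a.s ≫ u₁) = (quotFunctor S).map (b.s ≫ u₂) := by
    obtain ⟨Y, u₂, u₁, hu₁, e⟩ := h.exists_left (inv (S.Q.map b.s) ≫ S.Q.map a.s)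
    have := (h.iff_isIso _).1 hu₁
    have hu₂ : S u₂ := by rw [h.iff_isIso, ← e]; infer_instance
    rw [Category.assoc, IsIso.inv_comp_eq, ← S.Q.map_comp, ← S.Q.map_comp] at e
    obtain ⟨Y', y, hy, e⟩ := h.exists_postcomp _ _ e
    exact ⟨Y', u₁ ≫ y, u₂ ≫ y, h.comp_mem _ _ hu₁ hy, h.comp_mem _ _ hu₂ hy, by simpa using e⟩
  have hat := (h.sSat_iff _).1 a.ht
  have has := (h.sSat_iff _).1 a.hs
  refine ⟨Z, Y, v₁ ≫ a.t, a.s ≫ u₁, v₁, v₂, u₁, u₂, ?_, ?_, (h.sSat_iff _).2 hv₁,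
    (h.sSat_iff _).2 hv₂, (h.sSat_iff _).2 hu₁, (h.sSat_iff _).2 hu₂, rfl, eu, rfl, ev, ?_⟩
  · exact (h.sSat_iff _).2 (h.comp_mem _ _ hv₁ hat)
  · exact (h.sSat_iff _).2 (h.comp_mem _ _ has hu₁)
  · rw [← unit_eq_iff h Λ, ← pull_push_comp_ofTriplet h Λ a v₁ u₁ rfl rfl, hab,
      pull_push_comp_ofTriplet h Λ b v₂ u₂ (h.map_eq' _ _ ev) (h.map_eq' _ _ eu)]

/-- The identification of classes of triplets with extensions in the localization. -/
noncomputable def frac (K A : C) :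
    TripletClass X S K A ≃ (Λ.str h).Ext (S.Q.obj K) (S.Q.obj A) :=
  Equiv.ofBijective (Quot.lift (Λ.ofTriplet h) (Λ.ofTriplet_eq_of_rel h)) (by
    constructor
    · rintro ⟨a⟩ ⟨b⟩ hab
      exact Quot.sound (rel_of_ofTriplet_eq h Λ a b hab)
    · intro e
      obtain ⟨Z, Y, t, s, δ, ht, hs, he⟩ := exists_fraction h Λ e
      exact ⟨Quot.mk _ ⟨t, (h.sSat_iff t).2 ht, δ, s, (h.sSat_iff s).2 hs⟩,
        (ofTriplet_eq_iff h Λ _ e).2 he⟩)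

lemma pull_push_frac {K A Z Y : C} (t : Z ⟶ K) (ht : sSat S t) (δ : X.Ext Z Y) (s : A ⟶ Y)
    (hs : sSat S s) : pull (S.Q.map t) (push (S.Q.map s)
      (Λ.frac h K A (tripletClass t ht δ s hs))) = Λ.unit h δ :=
  pull_push_ofTriplet h Λ ⟨t, ht, δ, s, hs⟩

lemma frac_eq_iff {K A Z Y : C} (t : Z ⟶ K) (ht : sSat S t) (δ : X.Ext Z Y) (s : A ⟶ Y)
    (hs : sSat S s) (e : (Λ.str h).Ext (S.Q.obj K) (S.Q.obj A)) :
    Λ.frac h K A (tripletClass t ht δ s hs) = e ↔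
      pull (S.Q.map t) (push (S.Q.map s) e) = Λ.unit h δ :=
  ofTriplet_eq_iff h Λ ⟨t, ht, δ, s, hs⟩ e

include hX h hT Λ in
lemma nonempty_exactLocalization : Nonempty (ExactLocalization X S) := by
  have := hasZeroObject_localization (S := S)
  have := hasBinaryBiproducts_localization (S := S)
  refine ⟨{
    Q_additive := inferInstance
    str := Λ.str h
    weak := Λ.isWeaklyExtriangulated_str hX h hT
    frac := Λ.frac h
    frac_add := ?_
    push_frac := ?_
    pull_frac := ?_
    real_frac := ?_
    μ := ⟨fun K A => Λ.μ K A, Λ.unit_push h, Λ.unit_pull h⟩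
    μ_app := ?_
    μ_preserves := ?_ }⟩
  · intro K A Z Y t ht δ₁ δ₂ s hs
    rw [frac_eq_iff, push_add, pull_add, pull_push_frac, pull_push_frac]
    exact (map_add (Λ.μ Z Y) δ₁ δ₂).symm
  · intro K A A' Z Y G Y' t ht δ s hs α a r hr hα a' s' hs' e
    symm
    rw [frac_eq_iff, S.Q.map_comp, ← push_comp, reassoc_of% hα, ← S.Q.map_comp,
      ← h.map_eq' _ _ e, S.Q.map_comp, push_comp, pull_push, pull_push_frac, unit_push]
  · intro K K' A Z Y G Z' t ht δ s hs γ c r hr hγ c' t' ht' e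
    symm
    rw [frac_eq_iff, S.Q.map_comp, ← pull_push, ← pull_comp, Category.assoc, hγ, ← S.Q.map_comp,
      ← h.map_eq' _ _ e, S.Q.map_comp, pull_comp, pull_push_frac, unit_pull]
  · intro K A Z Y B t ht δ s hs x y hδ
    exact (isTriangle_str_iff hX h hT Λ _ _ _).2 (isReal_of_fraction h Λ ((h.sSat_iff t).1 ht)
      ((h.sSat_iff s).1 hs) (pull_push_frac h Λ t ht δ s hs) hδ)
  · intro K A δ
    symm
    rw [frac_eq_iff]
    simp
    rfl
  · intro A B K x y δ hδ
    refine (isTriangle_str_iff hX h hT Λ _ _ _).2 ⟨_, _, _, x, y, δ, Iso.refl _, Iso.refl _,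
      Iso.refl _, hδ, by simp, by simp, ?_⟩
    exact (push_id (X := Λ.str h) _).trans (pull_id (X := Λ.str h) _).symm

end Frac

end LocalizedExt

/-! ### The universal property -/

lemma isCompatibleWithTriangles_of_exactFunctor {C : Type u} [Category.{v} C] {pC : Preadditive C}
    {D : Type u'} [Category.{v'} D] {pD : Preadditive D} [HasBinaryBiproducts D]
    {X : ExtStructure.{w} C} {Y : ExtStructure.{w'} D} (hY : Y.IsWeaklyExtriangulated)
    (F : ExactFunctor X Y) {S : MorphismProperty C}
    (hS : S = (MorphismProperty.isomorphisms D).inverseImage F.F) :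
    IsCompatibleWithTriangles X S := by
  subst hS
  intro A B K A' B' K' x y δ x' y' δ' hδ hδ' a b c hac hab hbc ha hc
  have : IsIso (F.F.map a) := ha
  have : IsIso (F.F.map c) := hc
  refine hY.isIso_mid (F.preserves _ _ _ hδ) (F.preserves _ _ _ hδ') (F.F.map a) (F.F.map b)
    (F.F.map c) ?_ ?_ ?_
  · rw [← F.φ.push_app, hac, F.φ.pull_app]
  · rw [← F.F.map_comp, hab, F.F.map_comp]
  · rw [← F.F.map_comp, hbc, F.F.map_comp]

lemma ExactFunctor.eq_mk {C : Type u} [Category.{v} C] {pC : Preadditive C}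
    {D : Type u'} [Category.{v'} D] {pD : Preadditive D} {X : ExtStructure.{w} C}
    {Y : ExtStructure.{w'} D} (H : ExactFunctor X Y) (a : H.F.Additive) (φ : ExtTrans X Y H.F)
    (p : φ.PreservesTriangles) (e : H.φ = φ) : H = ⟨H.F, a, φ, p⟩ := by
  subst e
  rfl

lemma ExactFunctor.φ_eq_of_eq_mk {C : Type u} [Category.{v} C] {pC : Preadditive C}
    {D : Type u'} [Category.{v'} D] {pD : Preadditive D} {X : ExtStructure.{w} C}
    {Y : ExtStructure.{w'} D} (H : ExactFunctor X Y) (a : H.F.Additive) (φ : ExtTrans X Y H.F)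
    (p : φ.PreservesTriangles) (e : H = ⟨H.F, a, φ, p⟩) : H.φ = φ := by
  obtain ⟨F, a', ψ, p'⟩ := H
  exact eq_of_heq (ExactFunctor.mk.inj e).2

section Lift

variable {C : Type u} [Category.{v} C] {pC : Preadditive C} {X : ExtStructure.{w} C}
  {S : MorphismProperty C} (h : HasQuotientCalculus S) (L : ExactLocalization X S)

namespace ExactLocalization

lemma tripletClass_congr {K A Z Y : C} {t t' : Z ⟶ K} (ht : sSat S t) (ht' : sSat S t')
    {δ δ' : X.Ext Z Y} {s s' : A ⟶ Y} (hs : sSat S s) (hs' : sSat S s') (e₁ : t = t')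
    (e₂ : δ = δ') (e₃ : s = s') : tripletClass t ht δ s hs = tripletClass t' ht' δ' s' hs' := by
  subst e₁ e₂ e₃
  rfl

lemma pull_push_frac {K A Z Y : C} (t : Z ⟶ K) (ht : sSat S t) (δ : X.Ext Z Y) (s : A ⟶ Y)
    (hs : sSat S s) : pull (S.Q.map t) (push (S.Q.map s)
      (L.frac K A (tripletClass t ht δ s hs))) = L.μ.app Z Y δ := by
  rw [L.push_frac t ht δ s hs (S.Q.map s) s (𝟙 Y) (sSat_id S Y) (by simp) (𝟙 Y) (𝟙 Y)
    (sSat_id S Y) rfl, L.pull_frac _ _ _ _ _ (S.Q.map t) t (𝟙 Z) (sSat_id S Z) (by simp) (𝟙 Z)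
    (𝟙 Z) (sSat_id S Z) rfl, L.μ_app]
  congr 1
  exact tripletClass_congr _ _ _ _ (by simp) (by simp) (by simp)

lemma exists_fraction {K A : C} (e : L.str.Ext (S.Q.obj K) (S.Q.obj A)) :
    ∃ (Z Y : C) (t : Z ⟶ K) (ht : sSat S t) (δ : X.Ext Z Y) (s : A ⟶ Y) (hs : sSat S s),
      e = L.frac K A (tripletClass t ht δ s hs) := by
  obtain ⟨⟨⟨t, ht, δ, s, hs⟩⟩, rfl⟩ := (L.frac K A).surjective e
  exact ⟨_, _, t, ht, δ, s, hs, rfl⟩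

include h

lemma isIso_of_sSat {A B : C} {s : A ⟶ B} (hs : sSat S s) : IsIso (S.Q.map s) :=
  (h.iff_isIso s).1 ((h.sSat_iff s).1 hs)

lemma frac_eq_iff {K A Z Y : C} (t : Z ⟶ K) (ht : sSat S t) (δ : X.Ext Z Y) (s : A ⟶ Y)
    (hs : sSat S s) (e : L.str.Ext (S.Q.obj K) (S.Q.obj A)) :
    e = L.frac K A (tripletClass t ht δ s hs) ↔
      pull (S.Q.map t) (push (S.Q.map s) e) = L.μ.app Z Y δ := by
  have := isIso_of_sSat h ht
  have := isIso_of_sSat h hs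
  refine ⟨?_, fun he => ?_⟩
  · rintro rfl
    exact L.pull_push_frac t ht δ s hs
  · rw [← L.pull_push_frac t ht δ s hs] at he
    exact push_injective_of_isIso _ (pull_injective_of_isIso _ he)

/-- Two extensions in the localization have common denominators. -/
lemma exists_fraction₂ {K A : C} (e e' : L.str.Ext (S.Q.obj K) (S.Q.obj A)) :
    ∃ (Z Y : C) (t : Z ⟶ K) (_ : sSat S t) (δ δ' : X.Ext Z Y) (s : A ⟶ Y) (_ : sSat S s),
      pull (S.Q.map t) (push (S.Q.map s) e) = L.μ.app Z Y δ ∧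
      pull (S.Q.map t) (push (S.Q.map s) e') = L.μ.app Z Y δ' := by
  obtain ⟨Z₁, Y₁, t₁, ht₁, δ₁, s₁, hs₁, he⟩ := L.exists_fraction e
  obtain ⟨Z₂, Y₂, t₂, ht₂, δ₂, s₂, hs₂, he'⟩ := L.exists_fraction e'
  rw [L.frac_eq_iff h] at he he'
  have := isIso_of_sSat h ht₁
  have := isIso_of_sSat h hs₁
  have := isIso_of_sSat h ht₂
  have := isIso_of_sSat h hs₂
  obtain ⟨Z, v₂, v₁, hv₁, ev⟩ := h.exists_right (S.Q.map t₁ ≫ inv (S.Q.map t₂))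
  obtain ⟨Y, u₂, u₁, hu₁, eu⟩ := h.exists_left (inv (S.Q.map s₂) ≫ S.Q.map s₁)
  rw [← Category.assoc, IsIso.comp_inv_eq] at ev
  rw [Category.assoc, IsIso.inv_comp_eq] at eu
  refine ⟨Z, Y, v₁ ≫ t₁, sSat_comp _ _ _ ((h.sSat_iff _).2 hv₁) ht₁, pull v₁ (push u₁ δ₁),
    pull v₂ (push u₂ δ₂), s₁ ≫ u₁, sSat_comp _ _ _ hs₁ ((h.sSat_iff _).2 hu₁), ?_, ?_⟩
  · rw [L.μ.pull_app, L.μ.push_app, ← he, S.Q.map_comp, S.Q.map_comp, pull_comp, push_comp,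
      pull_push (S.Q.map t₁)]
  · rw [L.μ.pull_app, L.μ.push_app, ← he', S.Q.map_comp, S.Q.map_comp, ev, eu, pull_comp, push_comp,
      pull_push (S.Q.map t₂)]

end ExactLocalization

variable {D : Type u'} [Category.{v'} D] {pD : Preadditive D} {Y : ExtStructure.{w'} D}

section

variable (G : S.Localization ⥤ D) (φ : ExtTrans X Y (S.Q ⋙ G))

/-- The image of a triplet `(t \ δ / s)` under the extension of `φ` to the localization. -/
noncomputable def liftTriplet {K A : C} (a : Triplet X S K A) :
    Y.Ext (G.obj (S.Q.obj K)) (G.obj (S.Q.obj A)) :=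
  haveI := ExactLocalization.isIso_of_sSat h a.ht
  haveI := ExactLocalization.isIso_of_sSat h a.hs
  pull (inv (G.map (S.Q.map a.t))) (push (inv (G.map (S.Q.map a.s))) (φ.app a.Z a.Y a.δ))

lemma pull_push_liftTriplet {K A : C} (a : Triplet X S K A) :
    pull (G.map (S.Q.map a.t)) (push (G.map (S.Q.map a.s)) (liftTriplet h G φ a)) =
      φ.app a.Z a.Y a.δ := by
  have := ExactLocalization.isIso_of_sSat h a.ht
  have := ExactLocalization.isIso_of_sSat h a.hs
  rw [liftTriplet, pull_push, ← pull_comp, IsIso.hom_inv_id, pull_id, ← push_comp,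
    IsIso.inv_hom_id, push_id]

include h in
lemma app_eq_zero_of_killed {K A : C} {δ : X.Ext K A} (hδ : killed X S δ) :
    φ.app K A δ = 0 := by
  obtain ⟨A', s, hs, e⟩ := hδ
  have := ExactLocalization.isIso_of_sSat h hs
  have : IsIso ((S.Q ⋙ G).map s) := inferInstanceAs (IsIso (G.map (S.Q.map s)))
  apply push_injective_of_isIso ((S.Q ⋙ G).map s)
  rw [← φ.push_app, e, map_zero, push_zero]

lemma pull_push_comp_liftTriplet {K A : C} (a : Triplet X S K A) {Z Y' : C} {t : Z ⟶ K}
    {s : A ⟶ Y'} (v : Z ⟶ a.Z) (r : a.Y ⟶ Y') (ht : S.Q.map t = S.Q.map (v ≫ a.t))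
    (hs : S.Q.map s = S.Q.map (a.s ≫ r)) :
    pull (G.map (S.Q.map t)) (push (G.map (S.Q.map s)) (liftTriplet h G φ a)) =
      φ.app Z Y' (pull v (push r a.δ)) := by
  rw [ht, hs, φ.pull_app, φ.push_app, ← pull_push_liftTriplet h, S.Q.map_comp, S.Q.map_comp,
    G.map_comp, G.map_comp, pull_comp, push_comp, pull_push (G.map (S.Q.map a.t))]
  rfl

lemma liftTriplet_eq_of_rel {K A : C} (a b : Triplet X S K A) (hab : a.Rel b) :
    liftTriplet h G φ a = liftTriplet h G φ b := by
  obtain ⟨Z, Y, t, s, v₁, v₂, u₁, u₂, ht, hs, -, -, -, -, e₁, e₂, e₃, e₄, hk⟩ := hab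
  have := ExactLocalization.isIso_of_sSat h ht
  have := ExactLocalization.isIso_of_sSat h hs
  apply push_injective_of_isIso (G.map (S.Q.map s))
  apply pull_injective_of_isIso (G.map (S.Q.map t))
  rw [pull_push_comp_liftTriplet h G φ a v₁ u₁ (h.map_eq' _ _ e₃) (h.map_eq' _ _ e₁),
    pull_push_comp_liftTriplet h G φ b v₂ u₂ (h.map_eq' _ _ e₄) (h.map_eq' _ _ e₂),
    ← sub_eq_zero, ← map_sub]
  exact app_eq_zero_of_killed h G φ hk

/-- The extension of `φ` to the localization, as a map of sets. -/
noncomputable def liftFun {K A : C} (e : L.str.Ext (S.Q.obj K) (S.Q.obj A)) :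
    Y.Ext (G.obj (S.Q.obj K)) (G.obj (S.Q.obj A)) :=
  Quot.lift (liftTriplet h G φ) (liftTriplet_eq_of_rel h G φ) ((L.frac K A).symm e)

lemma pull_push_liftFun {K A Z Y' : C} {t : Z ⟶ K} (ht : sSat S t) {δ : X.Ext Z Y'} {s : A ⟶ Y'}
    (hs : sSat S s) {e : L.str.Ext (S.Q.obj K) (S.Q.obj A)}
    (he : pull (S.Q.map t) (push (S.Q.map s) e) = L.μ.app Z Y' δ) :
    pull (G.map (S.Q.map t)) (push (G.map (S.Q.map s)) (liftFun h L G φ e)) = φ.app Z Y' δ := by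
  obtain rfl := (L.frac_eq_iff h t ht δ s hs e).2 he
  rw [liftFun, Equiv.symm_apply_apply]
  exact pull_push_liftTriplet h G φ ⟨t, ht, δ, s, hs⟩

lemma liftFun_eq {K A Z Y' : C} {t : Z ⟶ K} (ht : sSat S t) {δ : X.Ext Z Y'} {s : A ⟶ Y'}
    (hs : sSat S s) {e : L.str.Ext (S.Q.obj K) (S.Q.obj A)}
    (he : pull (S.Q.map t) (push (S.Q.map s) e) = L.μ.app Z Y' δ)
    {d : Y.Ext (G.obj (S.Q.obj K)) (G.obj (S.Q.obj A))}
    (hd : pull (G.map (S.Q.map t)) (push (G.map (S.Q.map s)) d) = φ.app Z Y' δ) :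
    liftFun h L G φ e = d := by
  have := ExactLocalization.isIso_of_sSat h ht
  have := ExactLocalization.isIso_of_sSat h hs
  rw [← pull_push_liftFun h L G φ ht hs he] at hd
  exact (push_injective_of_isIso _ (pull_injective_of_isIso _ hd)).symm

lemma liftFun_add {K A : C} (e e' : L.str.Ext (S.Q.obj K) (S.Q.obj A)) :
    liftFun h L G φ (e + e') = liftFun h L G φ e + liftFun h L G φ e' := by
  obtain ⟨Z, Y', t, ht, δ, δ', s, hs, he, he'⟩ := L.exists_fraction₂ h e e'
  refine liftFun_eq h L G φ ht hs (δ := δ + δ') ?_ ?_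
  · rw [push_add, pull_add, he, he', map_add]
  · rw [push_add, pull_add, pull_push_liftFun h L G φ ht hs he,
      pull_push_liftFun h L G φ ht hs he', map_add]

lemma liftFun_push {K A A' : C} (α : S.Q.obj A ⟶ S.Q.obj A')
    (e : L.str.Ext (S.Q.obj K) (S.Q.obj A)) :
    liftFun h L G φ (push α e) = push (G.map α) (liftFun h L G φ e) := by
  obtain ⟨Z, Y', t, ht, δ, s, hs, he⟩ := L.exists_fraction e
  rw [L.frac_eq_iff h] at he
  have := ExactLocalization.isIso_of_sSat h hs
  obtain ⟨A₁, a, s', hs', ha⟩ := h.exists_left (inv (S.Q.map s) ≫ α)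
  rw [Category.assoc, IsIso.inv_comp_eq] at ha
  refine liftFun_eq h L G φ ht ((h.sSat_iff _).2 hs') (δ := push a δ) ?_ ?_
  · rw [← push_comp, ha, push_comp, pull_push, he, L.μ.push_app]
  · rw [← push_comp, ← G.map_comp, ha, G.map_comp, push_comp, pull_push,
      pull_push_liftFun h L G φ ht hs he, φ.push_app]
    rfl

lemma liftFun_pull {K K' A : C} (γ : S.Q.obj K' ⟶ S.Q.obj K)
    (e : L.str.Ext (S.Q.obj K) (S.Q.obj A)) :
    liftFun h L G φ (pull γ e) = pull (G.map γ) (liftFun h L G φ e) := by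
  obtain ⟨Z, Y', t, ht, δ, s, hs, he⟩ := L.exists_fraction e
  rw [L.frac_eq_iff h] at he
  have := ExactLocalization.isIso_of_sSat h ht
  obtain ⟨K₁, c, t', ht', hc⟩ := h.exists_right (γ ≫ inv (S.Q.map t))
  rw [← Category.assoc, IsIso.comp_inv_eq] at hc
  refine liftFun_eq h L G φ ((h.sSat_iff _).2 ht') hs (δ := pull c δ) ?_ ?_
  · rw [← pull_push, ← pull_comp, hc, pull_comp, he, L.μ.pull_app]
  · rw [← pull_push, ← pull_comp, ← G.map_comp, hc, G.map_comp, pull_comp,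
      pull_push_liftFun h L G φ ht hs he, φ.pull_app]
    rfl

/-- The extension of `φ` to the localization. -/
noncomputable def liftTrans : ExtTrans L.str Y G where
  app K A := AddMonoidHom.mk' (fun e => liftFun h L G φ (K := K.as.obj) (A := A.as.obj) e)
    fun e e' => liftFun_add h L G φ (K := K.as.obj) (A := A.as.obj) e e'
  push_app {K A A'} α e :=
    liftFun_push h L G φ (K := K.as.obj) (A := A.as.obj) (A' := A'.as.obj) α e
  pull_app {K K' A} γ e :=
    liftFun_pull h L G φ (K := K.as.obj) (K' := K'.as.obj) (A := A.as.obj) γ e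

lemma liftTrans_app {K A : C} (e : L.str.Ext (S.Q.obj K) (S.Q.obj A)) :
    (liftTrans h L G φ).app (S.Q.obj K) (S.Q.obj A) e = liftFun h L G φ e := rfl

lemma liftTrans_app_μ {K A : C} (δ : X.Ext K A) :
    (liftTrans h L G φ).app (S.Q.obj K) (S.Q.obj A) (L.μ.app K A δ) = φ.app K A δ := by
  rw [liftTrans_app]
  exact liftFun_eq h L G φ (sSat_id S K) (sSat_id S A) (δ := δ) (by simp) (by simp)

lemma liftTrans_preserves [HasBinaryBiproducts D] (hY : Y.IsWeaklyExtriangulated)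
    (hφ : φ.PreservesTriangles) : (liftTrans h L G φ).PreservesTriangles := by
  intro A B K x y e he
  obtain ⟨A, rfl⟩ := exists_obj_eq A
  obtain ⟨K, rfl⟩ := exists_obj_eq K
  obtain ⟨Z, Y', t, ht, δ, s, hs, rfl⟩ := L.exists_fraction e
  have := ExactLocalization.isIso_of_sSat h ht
  have := ExactLocalization.isIso_of_sSat h hs
  let _ := L.preadditive
  obtain ⟨B₀, x₀, y₀, hδ⟩ := exists_isTriangle δ
  have hr := L.real_frac t ht δ s hs x₀ y₀ hδ
  obtain ⟨b, rfl, hb⟩ := (seqClass_eq_iff _ _ _ _).1 (hr.symm.trans he)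
  refine hY.isTriangle_of_iso (hφ x₀ y₀ δ hδ) (inv (G.map (S.Q.map s))) (G.map b.hom)
    (G.map (S.Q.map t)) ?_ ?_ ?_
  · rw [liftTrans_app, ← pull_push_liftFun h L G φ ht hs (L.pull_push_frac t ht δ s hs), pull_push,
      ← push_comp]
    simp
  · simp
  · rw [← G.map_comp, hb]
    simp

end

include h in
lemma additive_of_comp [P : Preadditive S.Localization] [S.Q.Additive] (G : S.Localization ⥤ D)
    [(S.Q ⋙ G).Additive] : G.Additive := by
  refine ⟨fun {A B f g} => ?_⟩
  obtain ⟨A, rfl⟩ := exists_obj_eq A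
  obtain ⟨B, rfl⟩ := exists_obj_eq B
  obtain ⟨B', a, b, s, hs, ha, hb⟩ := h.exists_left₂ f g
  have := (h.iff_isIso s).1 hs
  rw [← cancel_mono (G.map (S.Q.map s)), ← G.map_comp, Preadditive.add_comp, ha, hb,
    ← S.Q.map_add, Preadditive.add_comp, ← G.map_comp, ← G.map_comp, ha, hb]
  exact (S.Q ⋙ G).map_add

variable [HasBinaryBiproducts D]

include h in
lemma exists_lift (hY : Y.IsWeaklyExtriangulated) (F : ExactFunctor X Y)
    (hF : S.IsInvertedBy F.F) : ∃ G : ExactFunctor L.str Y, L.functor.comp G = F := by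
  obtain ⟨F, hadd, φ, hφ⟩ := F
  obtain ⟨G, rfl⟩ : ∃ G, S.Q ⋙ G = F := ⟨_, Localization.Construction.fac F hF⟩
  let _ := L.preadditive
  have := L.Q_additive
  let H : ExactFunctor L.str Y :=
    ⟨G, additive_of_comp h G, liftTrans h L G φ, liftTrans_preserves h L G φ hY hφ⟩
  refine ⟨H, ExactFunctor.eq_mk (L.functor.comp H) hadd φ hφ ?_⟩
  ext K A δ
  exact liftTrans_app_μ h L G φ δ

include h in
lemma lift_unique (G₁ G₂ : ExactFunctor L.str Y) (e : L.functor.comp G₁ = L.functor.comp G₂) :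
    G₁ = G₂ := by
  obtain ⟨G₁, hadd₁, φ₁, hφ₁⟩ := G₁
  obtain ⟨G₂, hadd₂, φ₂, hφ₂⟩ := G₂
  obtain rfl : G₁ = G₂ := Localization.Construction.uniq _ _ (congrArg ExactFunctor.F e)
  have e' : ∀ {K A : C} (δ : X.Ext K A), φ₁.app _ _ (L.μ.app K A δ) = φ₂.app _ _ (L.μ.app K A δ) := by
    intro K A δ
    exact DFunLike.congr_fun (congrFun (congrFun (congrArg ExtTrans.app
      (ExactFunctor.φ_eq_of_eq_mk (L.functor.comp ⟨G₁, hadd₁, φ₁, hφ₁⟩) _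
        (L.functor.comp ⟨G₁, hadd₂, φ₂, hφ₂⟩).φ (L.functor.comp ⟨G₁, hadd₂, φ₂, hφ₂⟩).preserves e)) K) A) δ
  obtain rfl : φ₁ = φ₂ := by
    ext K A d
    obtain ⟨A, rfl⟩ := exists_obj_eq A
    obtain ⟨K, rfl⟩ := exists_obj_eq K
    obtain ⟨Z, Y', t, ht, δ, s, hs, he⟩ := L.exists_fraction d
    rw [L.frac_eq_iff h] at he
    have := ExactLocalization.isIso_of_sSat h ht
    have := ExactLocalization.isIso_of_sSat h hs
    apply push_injective_of_isIso (G₁.map (S.Q.map s))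
    apply pull_injective_of_isIso (G₁.map (S.Q.map t))
    rw [← φ₁.push_app, ← φ₁.pull_app, ← φ₂.push_app, ← φ₂.pull_app, he, e']
  rfl

end Lift

end ExtriLoc

theorem corollary3p6
    {C : Type u} [Category.{v} C] [Preadditive C] [HasZeroObject C] [HasBinaryBiproducts C]
    {D : Type u'} [Category.{v'} D] [Preadditive D] [HasZeroObject D] [HasBinaryBiproducts D]
    (X : ExtriLoc.ExtStructure.{w} C) (hX : X.IsExtriangulated)
    (Y : ExtriLoc.ExtStructure.{w'} D) (hY : Y.IsWeaklyExtriangulated)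
    (F : ExtriLoc.ExactFunctor X Y)
    (S : MorphismProperty C) (hS : S = (MorphismProperty.isomorphisms D).inverseImage F.F)
    (hMR2 : ExtriLoc.IsMultiplicativeSystem S ∨
      ExtriLoc.IsMultiplicativeSystem (ExtriLoc.sBar S)) :
    Nonempty (ExtriLoc.ExactLocalization X S) ∧
      ∀ L : ExtriLoc.ExactLocalization X S,
        ∃! G : ExtriLoc.ExactFunctor L.str Y, L.functor.comp G = F := by
  have := F.additive
  have h := ExtriLoc.hasQuotientCalculus F.F hS hMR2
  have hT : ExtriLoc.IsCompatibleWithTriangles X S :=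
    ExtriLoc.isCompatibleWithTriangles_of_exactFunctor hY F hS
  constructor
  · obtain ⟨_, _⟩ := h.exists_preadditive
    obtain ⟨Λ⟩ := ExtriLoc.exists_localizedExt hX.toIsWeaklyExtriangulated h hT
    exact Λ.nonempty_exactLocalization hX.toIsWeaklyExtriangulated h hT
  · intro L
    obtain ⟨G, hG⟩ := ExtriLoc.exists_lift h L hY F
      fun _ _ f hf => (ExtriLoc.mem_iff_isIso_map F.F hS f).1 hf
    exact ⟨G, hG, fun G' hG' => ExtriLoc.lift_unique h L G' G (hG'.trans hG.symm)⟩
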